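/- Fix an integer $k\ge 1$ and a real $q>0$, and let $\sigma=12\cdots(k+1)$ be the increasing pattern of length $k+1$. A permutation $\pi$ of $\{1,\dots,n\}$ contains $\sigma$ if there are indices $i_1<\dots<i_{k+1}$ with $\pi(i_1)<\dots<\pi(i_{k+1})$, and avoids $\sigma$ otherwise. Let $I_n(\sigma)$ be the set of involutions of $\{1,\dots,n\}$ that avoid $\sigma$, let $\mathrm{fp}(\pi)$ be the number of fixed points of $\pi$, and let $\mathbb P_n^{q,\sigma}$ be the probability measure on $I_n(\sigma)$ with $\mathbb P_n^{q,\sigma}(\pi)\propto q^{\mathrm{fp}(\pi)}$. Let $\Pi_n$ be a random element of $I_n(\sigma)$ with distribution $\mathbb P_n^{q,\sigma}$. Then, as $n\to\infty$, \[ \mathrm{fp}(\Pi_{2n})\to_d X^q_{even}\qquad\text{and}\qquad \mathrm{fp}(\Pi_{2n-1})\to_d X^q_{odd}, \] where $X^q_{even}$ and $X^q_{odd}$ take values in the non-negative integers and have the probability mass functions \[ \mathbb P(X^q_{even}=i)=\begin{cases}\dfrac{2\,q^i}{(1+q)^k+(1-q)^k}\dbinom ki & i\text{ even}\\[2ex]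 0 & i\text{ odd}\end{cases} \qquad\text{and}\qquad \mathbb P(X^q_{odd}=i)=\begin{cases}\dfrac{2\,q^i}{(1+q)^k-(1-q)^k}\dbinom ki & i\text{ odd}\\[2ex] 0 & i\text{ even.}\end{cases} \] (These are non-negative and sum to $1$.) -/

import Mathlib

open MeasureTheory ProbabilityTheory Filter

noncomputable section

/-- `π` contains the pattern `σ`: at some increasing sequence of positions, the values of `π`
are in the same relative order as those of `σ`. -/
def ContainsPattern {n m : ℕ} (π : Equiv.Perm (Fin n)) (σ : Equiv.Perm (Fin m)) : Prop :=
  ∃ f : Fin m → Fin n, StrictMono f ∧ ∀ a b : Fin m, a < b → (π (f a) < π (f b) ↔ σ a < σ b)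

/-- The involutions of `Fin n` that avoid the pattern `σ`. -/
def AvoidingInvolution (n : ℕ) {m : ℕ} (σ : Equiv.Perm (Fin m)) : Type :=
  {π : Equiv.Perm (Fin n) // ¬ ContainsPattern π σ ∧ Function.Involutive π}

instance (n : ℕ) {m : ℕ} (σ : Equiv.Perm (Fin m)) : Finite (AvoidingInvolution n σ) :=
  inferInstanceAs (Finite {π : Equiv.Perm (Fin n) // ¬ ContainsPattern π σ ∧ Function.Involutive π})

instance (n : ℕ) {m : ℕ} (σ : Equiv.Perm (Fin m)) : Fintype (AvoidingInvolution n σ) :=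
  Fintype.ofFinite _

/-- Every set of pattern avoiding involutions is measurable. -/
instance (n : ℕ) {m : ℕ} (σ : Equiv.Perm (Fin m)) : MeasurableSpace (AvoidingInvolution n σ) := ⊤

/-- The number of fixed points of a permutation. -/
def fp {n : ℕ} (π : Equiv.Perm (Fin n)) : ℕ :=
  (Finset.univ.filter fun i => π i = i).card

/-- The total weight of the involutions of `Fin n` avoiding `σ`, where `π` has weight
`q ^ fp π`. -/
def totalWeight (q : ℝ) {m : ℕ} (σ : Equiv.Perm (Fin m)) (n : ℕ) : ℝ :=
  ∑ π : AvoidingInvolution n σ, q ^ fp π.1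

/-- The fixed point biased measure on the involutions of `Fin n` avoiding `σ`: the mass of `π` is
proportional to `q ^ fp π`. -/
def biasedMeasure (q : ℝ) {m : ℕ} (σ : Equiv.Perm (Fin m)) (n : ℕ) :
    Measure (AvoidingInvolution n σ) :=
  ∑ π : AvoidingInvolution n σ,
    ENNReal.ofReal (q ^ fp π.1 / totalWeight q σ n) • Measure.dirac π

/-- The increasing pattern `1 2 ⋯ (k+1)`. -/
def increasingPattern (k : ℕ) : Equiv.Perm (Fin (k + 1)) := Equiv.refl _

/-- The probability mass function of the limit along even lengths. -/
def evenMass (k : ℕ) (q : ℝ) (i : ℕ) : ℝ :=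
  if Even i then 2 * q ^ i * (k.choose i : ℝ) / ((1 + q) ^ k + (1 - q) ^ k) else 0

/-- The probability mass function of the limit along odd lengths. -/
def oddMass (k : ℕ) (q : ℝ) (i : ℕ) : ℝ :=
  if Odd i then 2 * q ^ i * (k.choose i : ℝ) / ((1 + q) ^ k - (1 - q) ^ k) else 0

end

/-! By the Robinson–Schensted correspondence an involution is a standard Young tableau. Its longest
increasing subsequence has the length of the first row, and its fixed points are as many as the
columns of odd length (Schützenberger). After transposition, `Growth.exists_equiv_ballotWords`
matches the avoiding involutions with ballot words over `k` letters, and fixed points with letters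
of odd multiplicity.

A ballot word is a walk in a Weyl chamber, and it remains to show that the parities of its
coordinates equidistribute, given that the coordinates sum to `n`. The commutation relation
`Chamber.up_down`, of the kind known from differential posets, implies that the number of walks
grows by a factor tending to `k`, so the proportion of forbidden steps tends to 0
(`Chamber.tendsto_numBallot_defect`). Hence the sign character of a set `T` of coordinates is almost
an eigenfunction of the step, with eigenvalue `k - 2|T|`. Unless `T` is empty or full, this is
smaller than `k` in absolute value and the average of the character tends to 0; the full set gives
`(-1)^n`.

Fourier inversion then shows that the proportion of words with `j` odd letters is asymptotically
`2^(-k) * choose k j * (1 + (-1)^(n+j))` (`Chamber.tendsto_numBallotOdd`). Weighting by `q^j` and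
normalising with the binomial theorem yields both limit laws. -/

noncomputable section

/-! ### Walks in a Weyl chamber -/

namespace Chamber

variable {k : ℕ}

/-- The sum of `φ` over the neighbours of `c` in the chamber with one more box. -/
def up (φ : (Fin k → ℤ) → ℝ) (c : Fin k → ℤ) : ℝ :=
  open Classical in ∑ i, if Antitone (c + Pi.single i 1) then φ (c + Pi.single i 1) else 0

/-- The sum of `φ` over the neighbours of `c` in the chamber with one box less, where the removal
of a box from `c i` has weight `c i + (k - 1 - i)`. -/
def down (φ : (Fin k → ℤ) → ℝ) (c : Fin k → ℤ) : ℝ :=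
  open Classical in ∑ i : Fin k, ((c i : ℝ) + (k - 1 - i)) *
    if Antitone (c - Pi.single i 1) then φ (c - Pi.single i 1) else 0

/-- The only obstruction to raising `c j` is an equal entry before it, and lowering another
coordinate cannot remove it. With the companion below, this matches the mixed terms of the two
compositions in `up_down`. -/
lemma antitone_add_of_antitone_add_sub {c : Fin k → ℤ} (hc : Antitone c) {i j : Fin k}
    (h : Antitone (c + Pi.single j 1 - Pi.single i 1)) (hij : i ≠ j) :
    Antitone (c + Pi.single j 1) := by
  intro a b hab
  have h1 := hc hab
  have h2 := h hab
  simp only [Pi.add_apply, Pi.sub_apply, Pi.single_apply] at h2 ⊢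
  split_ifs at h2 ⊢ <;> grind

lemma antitone_sub_of_antitone_add_sub {c : Fin k → ℤ} (hc : Antitone c) {i j : Fin k}
    (h : Antitone (c + Pi.single j 1 - Pi.single i 1)) (hij : i ≠ j) :
    Antitone (c - Pi.single i 1) := by
  intro a b hab
  have h1 := hc hab
  have h2 := h hab
  simp only [Pi.add_apply, Pi.sub_apply, Pi.single_apply] at h2 ⊢
  split_ifs at h2 ⊢ <;> grind

lemma antitone_add_single_zero {m : ℕ} {c : Fin (m + 1) → ℤ} (hc : Antitone c) :
    Antitone (c + Pi.single 0 1) := by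
  intro a b hab
  have h1 := hc hab
  simp only [Pi.add_apply, Pi.single_apply]
  have : b = 0 → a = 0 := fun h => by rw [h] at hab; exact Fin.le_zero_iff.1 hab
  split_ifs <;> grind

lemma antitone_sub_single_last {m : ℕ} {c : Fin (m + 1) → ℤ} (hc : Antitone c) :
    Antitone (c - Pi.single (Fin.last m) 1) := by
  intro a b hab
  have h1 := hc hab
  simp only [Pi.sub_apply, Pi.single_apply]
  have : a = Fin.last m → b = Fin.last m := fun h => by rw [h] at hab; exact Fin.last_le_iff.1 hab
  split_ifs <;> grind

lemma antitone_add_single_succ {m : ℕ} {c : Fin (m + 1) → ℤ} (hc : Antitone c) (j : Fin m) :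
    Antitone (c + Pi.single j.succ 1) ↔ c j.succ < c j.castSucc := by
  constructor
  · intro h
    have := h (Fin.castSucc_lt_succ (i := j)).le
    simp only [Pi.add_apply, Pi.single_apply, if_true, (Fin.castSucc_lt_succ (i := j)).ne,
      if_false] at this
    omega
  · intro h a b hab
    have h1 := hc hab
    simp only [Pi.add_apply, Pi.single_apply]
    rcases eq_or_ne b j.succ with hb | hb
    · subst hb
      rcases eq_or_ne a j.succ with ha | ha
      · simp [ha]
      · have : a ≤ j.castSucc := Fin.le_castSucc_iff.2 (lt_of_le_of_ne hab ha)
        have := hc this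
        simp only [ha, if_true, if_false]; omega
    · split_ifs <;> grind

lemma antitone_sub_single_castSucc {m : ℕ} {c : Fin (m + 1) → ℤ} (hc : Antitone c) (j : Fin m) :
    Antitone (c - Pi.single j.castSucc 1) ↔ c j.succ < c j.castSucc := by
  constructor
  · intro h
    have := h (Fin.castSucc_lt_succ (i := j)).le
    simp only [Pi.sub_apply, Pi.single_apply, if_true, (Fin.castSucc_lt_succ (i := j)).ne',
      if_false] at this
    omega
  · intro h a b hab
    have h1 := hc hab
    simp only [Pi.sub_apply, Pi.single_apply]
    rcases eq_or_ne a j.castSucc with ha | ha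
    · subst ha
      rcases eq_or_ne b j.castSucc with hb | hb
      · simp [hb]
      · have : j.succ ≤ b := Fin.castSucc_lt_iff_succ_le.1 (lt_of_le_of_ne hab hb.symm)
        have := hc this
        simp only [hb, if_true, if_false]; omega
    · split_ifs <;> grind

open Classical in
-- A box can be added to a row exactly when one can be removed from the row before it. The two
-- weights then differ by `c j.succ - c j.castSucc`, which vanishes in the remaining case, so the
-- sum telescopes.
lemma sum_addable_sub_sum_removable {c : Fin k → ℤ} (hc : Antitone c) :
    ∑ j : Fin k, ((if Antitone (c + Pi.single j 1) then (c j : ℝ) + 1 + (k - 1 - j) else 0) -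
      (if Antitone (c - Pi.single j 1) then (c j : ℝ) + (k - 1 - j) else 0)) = k := by
  cases k with
  | zero => simp
  | succ m =>
    rw [Finset.sum_sub_distrib, Fin.sum_univ_succ, Fin.sum_univ_castSucc (n := m)]
    simp only [antitone_add_single_zero hc, antitone_sub_single_last hc,
      antitone_add_single_succ hc, antitone_sub_single_castSucc hc, if_true]
    have key : ∀ j : Fin m,
        (if c j.succ < c j.castSucc then (c j.succ : ℝ) + 1 + (((m + 1 : ℕ) : ℝ) - 1 -
          ((j.succ : ℕ) : ℝ)) else 0) =
        (if c j.succ < c j.castSucc then (c j.castSucc : ℝ) + (((m + 1 : ℕ) : ℝ) - 1 -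
          ((j.castSucc : ℕ) : ℝ)) else 0) + (c j.succ - c j.castSucc) := by
      intro j
      have h1 := hc (Fin.castSucc_lt_succ (i := j)).le
      split_ifs with h
      · push_cast [Fin.val_succ, Fin.val_castSucc]; ring
      · have : c j.succ = c j.castSucc := by omega
        rw [this]; ring
    rw [Finset.sum_congr rfl fun j _ => key j, Finset.sum_add_distrib, Finset.sum_sub_distrib]
    have h1 := Fin.sum_univ_succ fun j : Fin (m + 1) => (c j : ℝ)
    have h2 := Fin.sum_univ_castSucc fun j : Fin (m + 1) => (c j : ℝ)
    push_cast [Fin.val_zero, Fin.val_last]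
    linarith

/-- The commutation relation between `up` and `down`. -/
lemma up_down {c : Fin k → ℤ} (hc : Antitone c) (φ : (Fin k → ℤ) → ℝ) :
    up (down φ) c = down (up φ) c + k * φ c := by
  classical
  have h1 : up (down φ) c = ∑ i : Fin k, ∑ j : Fin k, if Antitone (c + Pi.single j 1) then
      (((c + Pi.single j 1 : Fin k → ℤ) i : ℝ) + ((k : ℝ) - 1 - i)) *
        (if Antitone (c + Pi.single j 1 - Pi.single i 1) then
          φ (c + Pi.single j 1 - Pi.single i 1) else 0) else 0 := by
    rw [Finset.sum_comm]
    refine Finset.sum_congr rfl fun j _ => ?_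
    split_ifs
    · rfl
    · simp
  have h2 : down (up φ) c = ∑ i : Fin k, ∑ j : Fin k, (if Antitone (c - Pi.single i 1) then
      ((c i : ℝ) + ((k : ℝ) - 1 - i)) *
        (if Antitone (c + Pi.single j 1 - Pi.single i 1) then
          φ (c + Pi.single j 1 - Pi.single i 1) else 0) else 0) := by
    refine Finset.sum_congr rfl fun i _ => ?_
    split_ifs
    · simp only [up, Finset.mul_sum, sub_add_eq_add_sub]
    · simp
  rw [← sum_addable_sub_sum_removable hc, h1, h2, Finset.sum_mul, ← sub_eq_iff_eq_add',
    ← Finset.sum_sub_distrib]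
  refine Finset.sum_congr rfl fun i _ => ?_
  -- For `j ≠ i` both orders are allowed together and the weight of `i` is not affected by `j`, so
  -- only the diagonal survives.
  rw [← Finset.sum_sub_distrib, Finset.sum_eq_single i]
  · simp only [add_sub_cancel_right, hc, if_true, Pi.add_apply, Pi.single_eq_same]
    push_cast
    split_ifs <;> ring
  · intro j _ hj
    by_cases h : Antitone (c + Pi.single j 1 - Pi.single i 1)
    · simp [antitone_add_of_antitone_add_sub hc h hj.symm,
        antitone_sub_of_antitone_add_sub hc h hj.symm, hj.symm]
    · simp [h]
  · simp

/-- Nothing in the chamber forbids negative coordinates; the weights do. At the origin only the last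
coordinate can be lowered, and its weight is 0. -/
lemma down_zero (φ : (Fin k → ℤ) → ℝ) : down φ 0 = 0 := by
  cases k with
  | zero => simp [down]
  | succ m =>
    rw [down, Fin.sum_univ_castSucc, Finset.sum_eq_zero]
    · simp
    · intro j _
      rw [if_neg, mul_zero]
      rw [antitone_sub_single_castSucc (c := 0) antitone_const]
      simp

/-! ### Ballot words -/

/-- The number of occurrences of each letter among the first `m` letters of a word. -/
def prefixCount {n : ℕ} (w : Fin n → Fin k) (m : ℕ) : Fin k → ℤ :=
  fun i => ∑ j : Fin n, if (j : ℕ) < m ∧ w j = i then 1 else 0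

/-- A ballot word: in each prefix, smaller letters are at least as frequent as larger ones. -/
def IsBallot {n : ℕ} (w : Fin n → Fin k) : Prop :=
  ∀ m, Antitone (prefixCount w m)

/-- The ballot words of length `n`. -/
def ballotWords (k n : ℕ) : Finset (Fin n → Fin k) :=
  open Classical in Finset.univ.filter IsBallot

/-- The sum of `φ` over the end points of the ballot words of length `n`. -/
def ballotSum (n : ℕ) (φ : (Fin k → ℤ) → ℝ) : ℝ :=
  ∑ w ∈ ballotWords k n, φ (prefixCount w n)

lemma prefixCount_snoc_of_le {n : ℕ} (w : Fin n → Fin k) (a : Fin k) {m : ℕ} (hm : m ≤ n) :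
    prefixCount (Fin.snoc w a : Fin (n + 1) → Fin k) m = prefixCount w m := by
  funext i
  simp only [prefixCount, Fin.sum_univ_castSucc, Fin.snoc_castSucc, Fin.snoc_last,
    Fin.val_castSucc, Fin.val_last]
  simp [hm.not_gt]

lemma prefixCount_snoc_of_lt {n : ℕ} (w : Fin n → Fin k) (a : Fin k) {m : ℕ} (hm : n < m) :
    prefixCount (Fin.snoc w a : Fin (n + 1) → Fin k) m = prefixCount w n + Pi.single a 1 := by
  funext i
  simp only [prefixCount, Fin.sum_univ_castSucc, Fin.snoc_castSucc, Fin.snoc_last,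
    Fin.val_castSucc, Fin.val_last, Pi.add_apply, Pi.single_apply, hm, true_and]
  congr 1
  · refine Finset.sum_congr rfl fun j _ => ?_
    have : (j : ℕ) < m := j.2.trans hm
    simp [this]
  · simp [eq_comm]

lemma prefixCount_of_le {n : ℕ} (w : Fin n → Fin k) {m : ℕ} (hm : n ≤ m) :
    prefixCount w m = prefixCount w n := by
  funext i
  refine Finset.sum_congr rfl fun j _ => ?_
  simp [j.2, j.2.trans_le hm]

lemma isBallot_snoc {n : ℕ} (w : Fin n → Fin k) (a : Fin k) :
    IsBallot (Fin.snoc w a : Fin (n + 1) → Fin k) ↔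
      IsBallot w ∧ Antitone (prefixCount w n + Pi.single a 1) := by
  constructor
  · intro h
    refine ⟨fun m => ?_, ?_⟩
    · rcases le_total m n with hm | hm
      · simpa [prefixCount_snoc_of_le w a hm] using h m
      · rw [prefixCount_of_le w hm]
        simpa [prefixCount_snoc_of_le w a le_rfl] using h n
    · simpa [prefixCount_snoc_of_lt w a (Nat.lt_succ_self n)] using h (n + 1)
  · rintro ⟨h1, h2⟩ m
    rcases le_or_gt m n with hm | hm
    · simpa [prefixCount_snoc_of_le w a hm] using h1 m
    · simpa [prefixCount_snoc_of_lt w a hm] using h2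

lemma ballotSum_zero (φ : (Fin k → ℤ) → ℝ) : ballotSum 0 φ = φ 0 := by
  have h : ∀ (w : Fin 0 → Fin k) m, prefixCount w m = 0 := fun w m => by
    funext i; simp [prefixCount]
  have : ballotWords k 0 = Finset.univ := by
    simp only [ballotWords, Finset.filter_eq_self]
    intro w _ m
    rw [h]; exact antitone_const
  simp [ballotSum, this, h]

lemma ballotSum_succ (n : ℕ) (φ : (Fin k → ℤ) → ℝ) :
    ballotSum (n + 1) φ = ballotSum n (up φ) := by
  classical
  simp only [ballotSum, ballotWords, Finset.sum_filter]
  rw [← (Fin.snocEquiv fun _ : Fin (n + 1) => Fin k).sum_comp, Fintype.sum_prod_type,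
    Finset.sum_comm]
  refine Finset.sum_congr rfl fun w _ => ?_
  simp only [Fin.snocEquiv, Equiv.coe_fn_mk]
  split_ifs with h
  · refine Finset.sum_congr rfl fun a _ => ?_
    change (if IsBallot (Fin.snoc w a : Fin (n + 1) → Fin k) then _ else _) = _
    simp [isBallot_snoc, h, prefixCount_snoc_of_lt w a (Nat.lt_succ_self n)]
  · refine Finset.sum_eq_zero fun a _ => ?_
    exact if_neg fun h' => h ((isBallot_snoc w a).1 h').1

lemma prefixCount_nonneg {n : ℕ} (w : Fin n → Fin k) (m : ℕ) (i : Fin k) :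
    0 ≤ prefixCount w m i :=
  Finset.sum_nonneg fun j _ => by split_ifs <;> simp

lemma sum_prefixCount {n : ℕ} (w : Fin n → Fin k) : ∑ i, prefixCount w n i = n := by
  simp only [prefixCount, Fin.is_lt, true_and]
  rw [Finset.sum_comm]
  simp

lemma antitone_prefixCount {n : ℕ} {w : Fin n → Fin k} (hw : w ∈ ballotWords k n) (m : ℕ) :
    Antitone (prefixCount w m) := by
  simp only [ballotWords, Finset.mem_filter] at hw
  exact hw.2 m

lemma ballotSum_add (n : ℕ) (φ ψ : (Fin k → ℤ) → ℝ) :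
    ballotSum n (fun c => φ c + ψ c) = ballotSum n φ + ballotSum n ψ :=
  Finset.sum_add_distrib

lemma ballotSum_sub (n : ℕ) (φ ψ : (Fin k → ℤ) → ℝ) :
    ballotSum n (fun c => φ c - ψ c) = ballotSum n φ - ballotSum n ψ :=
  Finset.sum_sub_distrib ..

lemma ballotSum_const_mul (n : ℕ) (a : ℝ) (φ : (Fin k → ℤ) → ℝ) :
    ballotSum n (fun c => a * φ c) = a * ballotSum n φ :=
  (Finset.mul_sum ..).symm

lemma ballotSum_finset_sum {ι : Type*} (s : Finset ι) (n : ℕ) (φ : ι → (Fin k → ℤ) → ℝ) :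
    ballotSum n (fun c => ∑ i ∈ s, φ i c) = ∑ i ∈ s, ballotSum n (φ i) :=
  Finset.sum_comm

lemma abs_ballotSum_le (n : ℕ) (φ : (Fin k → ℤ) → ℝ) :
    |ballotSum n φ| ≤ ballotSum n fun c => |φ c| :=
  Finset.abs_sum_le_sum_abs ..

lemma ballotSum_mono (n : ℕ) {φ ψ : (Fin k → ℤ) → ℝ}
    (h : ∀ c : Fin k → ℤ, Antitone c → (∀ i, 0 ≤ c i) → ∑ i, c i = n → φ c ≤ ψ c) :
    ballotSum n φ ≤ ballotSum n ψ :=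
  Finset.sum_le_sum fun w hw => h _ (antitone_prefixCount hw n) (prefixCount_nonneg w n)
    (sum_prefixCount w)

lemma ballotSum_congr (n : ℕ) {φ ψ : (Fin k → ℤ) → ℝ}
    (h : ∀ c : Fin k → ℤ, Antitone c → (∀ i, 0 ≤ c i) → ∑ i, c i = n → φ c = ψ c) :
    ballotSum n φ = ballotSum n ψ :=
  Finset.sum_congr rfl fun w hw => h _ (antitone_prefixCount hw n) (prefixCount_nonneg w n)
    (sum_prefixCount w)

/-- Moving `down` past each of the `n + 1` steps `up` contributes `k`, and `down` finally vanishes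
at the origin. -/
lemma ballotSum_succ_down (n : ℕ) (φ : (Fin k → ℤ) → ℝ) :
    ballotSum (n + 1) (down φ) = k * (n + 1) * ballotSum n φ := by
  have step : ∀ (n : ℕ) (φ : (Fin k → ℤ) → ℝ),
      ballotSum (n + 1) (down φ) = ballotSum n (down (up φ)) + k * ballotSum n φ := by
    intro n φ
    rw [ballotSum_succ, ballotSum_congr n fun c hc _ _ => up_down hc φ, ballotSum_add,
      ballotSum_const_mul]
  induction n generalizing φ with
  | zero => rw [step, ballotSum_zero, down_zero]; simp
  | succ n ih =>
    rw [step, ih, ← ballotSum_succ]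
    push_cast
    ring

/-! ### Growth rate of the number of ballot words -/

/-- The number of ballot words of length `n`. -/
def numBallot (k n : ℕ) : ℝ := ballotSum (k := k) n fun _ => 1

lemma numBallot_succ_le (n : ℕ) : numBallot k (n + 1) ≤ k * numBallot k n := by
  rw [numBallot, numBallot, ballotSum_succ, ← ballotSum_const_mul]
  refine ballotSum_mono n fun c _ _ _ => ?_
  calc up (fun _ => 1) c ≤ ∑ _i : Fin k, (1 : ℝ) :=
        Finset.sum_le_sum fun i _ => by split_ifs <;> simp
    _ = k * 1 := by simp

/-- Apply `ballotSum_succ_down` to the constant 1: each weight is at most `c i + k`, so the weights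
add up to at most `n + 1 + k ^ 2`. -/
lemma le_numBallot_succ (n : ℕ) :
    k * (n + 1) * numBallot k n ≤ (n + 1 + k ^ 2) * numBallot k (n + 1) := by
  rw [numBallot, numBallot, ← ballotSum_succ_down, ← ballotSum_const_mul]
  refine ballotSum_mono (n + 1) fun c _ h0 hs => ?_
  have hnn : ∀ i : Fin k, 0 ≤ (c i : ℝ) + (k - 1 - i) := fun i => by
    have h1 : (0 : ℝ) ≤ c i := by exact_mod_cast h0 i
    have h2 : ((i : ℕ) : ℝ) + 1 ≤ k := by exact_mod_cast i.2
    linarith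
  have hs' : ∑ i, (c i : ℝ) = n + 1 := by exact_mod_cast hs
  calc down (fun _ => 1) c ≤ ∑ i : Fin k, ((c i : ℝ) + k) := by
        refine Finset.sum_le_sum fun i _ => ?_
        have h2 : (0 : ℝ) ≤ ((i : ℕ) : ℝ) := by positivity
        have := hnn i
        split_ifs
        · linarith
        · rw [mul_zero]; linarith
    _ = (n + 1 + k ^ 2) * 1 := by
        rw [Finset.sum_add_distrib, hs']; simp; ring

lemma numBallot_pos (hk : 1 ≤ k) (n : ℕ) : 0 < numBallot k n := by
  induction n with
  | zero => simp [numBallot, ballotSum_zero]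
  | succ n ih =>
    have h := le_numBallot_succ (k := k) n
    have hk' : (0 : ℝ) < k := by exact_mod_cast hk
    have : 0 < k * (n + 1) * numBallot k n := by positivity
    exact pos_of_mul_pos_right (this.trans_le h) (by positivity)

/-! ### Equidistribution of the parities -/

/-- The sign character of the parities of the coordinates in `T`. -/
def parityChar (T : Finset (Fin k)) (c : Fin k → ℤ) : ℝ := ∏ i ∈ T, (-1 : ℝ) ^ c i

lemma parityChar_add_single (T : Finset (Fin k)) (c : Fin k → ℤ) (i : Fin k) :
    parityChar T (c + Pi.single i 1) = (if i ∈ T then -1 else 1) * parityChar T c := by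
  have h : ∀ j, (-1 : ℝ) ^ (c + Pi.single i 1 : Fin k → ℤ) j =
      (if i = j then -1 else 1) * (-1 : ℝ) ^ c j := by
    intro j
    rcases eq_or_ne i j with rfl | hij
    · simp [zpow_add₀]
    · simp [hij, hij.symm]
  simp only [parityChar, h, Finset.prod_mul_distrib, Finset.prod_ite_eq]

lemma abs_parityChar (T : Finset (Fin k)) (c : Fin k → ℤ) : |parityChar T c| = 1 := by
  simp [parityChar, Finset.abs_prod, abs_zpow]

/-- Over all `k` neighbours, inside the chamber or not, the character sums to `k - 2 * T.card` times
its value. The right-hand side counts the neighbours outside the chamber. -/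
lemma abs_ballotSum_parityChar_succ_sub_le (T : Finset (Fin k)) (n : ℕ) :
    |ballotSum (n + 1) (parityChar T) - (k - 2 * T.card) * ballotSum n (parityChar T)| ≤
      k * numBallot k n - numBallot k (n + 1) := by
  classical
  simp only [numBallot]
  rw [ballotSum_succ, ballotSum_succ, ← ballotSum_const_mul, ← ballotSum_const_mul,
    ← ballotSum_sub, ← ballotSum_sub]
  refine (abs_ballotSum_le _ _).trans (ballotSum_mono n fun c _ _ _ => ?_)
  have h1 : (k - 2 * T.card) * parityChar T c =
      ∑ i, parityChar T (c + Pi.single i 1) := by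
    simp only [parityChar_add_single, ← Finset.sum_mul]
    congr 1
    have : ∀ i : Fin k, (if i ∈ T then (-1 : ℝ) else 1) = 1 - 2 * if i ∈ T then 1 else 0 := by
      intro i; split_ifs <;> norm_num
    simp [this, Finset.sum_sub_distrib, mul_comm]
  have h2 : (k : ℝ) * 1 = ∑ _i : Fin k, (1 : ℝ) := by simp
  rw [h1, h2, up, up, ← Finset.sum_sub_distrib, ← Finset.sum_sub_distrib]
  refine (Finset.abs_sum_le_sum_abs _ _).trans (Finset.sum_le_sum fun i _ => ?_)
  split_ifs
  · simp
  · simp [abs_parityChar]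

lemma tendsto_zero_of_le_mul_add {x e : ℕ → ℝ} {θ : ℝ} (hx : ∀ n, 0 ≤ x n) (hθ0 : 0 ≤ θ)
    (hθ : θ < 1) (he : Tendsto e atTop (nhds 0)) (h : ∀ n, x (n + 1) ≤ θ * x n + e n) :
    Tendsto x atTop (nhds 0) := by
  rw [Metric.tendsto_atTop]
  intro ε hε
  have hε' : 0 < (1 - θ) * (ε / 2) := mul_pos (by linarith) (by linarith)
  obtain ⟨N, hN⟩ := eventually_atTop.1 (he.eventually (gt_mem_nhds hε'))
  have hb : ∀ m, x (N + m) ≤ θ ^ m * x N + ε / 2 := by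
    intro m
    induction m with
    | zero => simp; linarith
    | succ m ih =>
      have h1 := h (N + m)
      have h2 := hN (N + m) (by omega)
      have h3 := mul_le_mul_of_nonneg_left ih hθ0
      rw [← add_assoc, pow_succ]
      linarith
  have hp : Tendsto (fun m => θ ^ m * x N) atTop (nhds 0) := by
    simpa using (tendsto_pow_atTop_nhds_zero_of_lt_one hθ0 hθ).mul_const (x N)
  obtain ⟨M, hM⟩ := eventually_atTop.1 (hp.eventually (gt_mem_nhds (half_pos hε)))
  refine ⟨N + M, fun n hn => ?_⟩
  have h1 := hb (n - N)
  have h2 := hM (n - N) (by omega)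
  rw [show N + (n - N) = n by omega] at h1
  rw [Real.dist_eq, sub_zero, abs_of_nonneg (hx n)]
  linarith

/-- The bounds on consecutive counts give `0 ≤ k - ratio ≤ k - k(n+1)/(n+1+k^2) ≤ k^3/(n+1)`. -/
lemma tendsto_numBallot_defect (hk : 1 ≤ k) :
    Tendsto (fun n => k - numBallot k (n + 1) / numBallot k n) atTop (nhds 0) := by
  have hlim : Tendsto (fun n : ℕ => (k : ℝ) ^ 3 * (1 / ((n : ℝ) + 1))) atTop (nhds 0) := by
    simpa using (tendsto_one_div_add_atTop_nhds_zero_nat (𝕜 := ℝ)).const_mul ((k : ℝ) ^ 3)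
  refine squeeze_zero (fun n => ?_) (fun n => ?_) hlim
  · have h := numBallot_pos hk n
    rw [sub_nonneg, div_le_iff₀ h]
    exact numBallot_succ_le n
  · have h := numBallot_pos hk n
    have h1 := le_numBallot_succ (k := k) n
    have h2 := numBallot_succ_le (k := k) n
    have hn : (0 : ℝ) < n + 1 := by positivity
    rw [sub_le_iff_le_add, ← sub_le_iff_le_add', le_div_iff₀ h, mul_one_div, sub_mul,
      sub_le_iff_le_add', div_mul_eq_mul_div, ← sub_le_iff_le_add, le_div_iff₀ hn]
    have h3 := mul_le_mul_of_nonneg_left h2 (sq_nonneg (k : ℝ))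
    nlinarith

lemma tendsto_ballotSum_parityChar (hk : 1 ≤ k) {T : Finset (Fin k)} (h0 : T ≠ ∅)
    (h1 : T ≠ Finset.univ) :
    Tendsto (fun n => ballotSum n (parityChar T) / numBallot k n) atTop (nhds 0) := by
  have hk' : (0 : ℝ) < k := by exact_mod_cast hk
  have hT0 : 0 < T.card := Finset.card_pos.2 (Finset.nonempty_iff_ne_empty.2 h0)
  have hT1 : T.card < k := by
    simpa using Finset.card_lt_univ_of_notMem
      (Classical.choose_spec (by simpa [Finset.eq_univ_iff_forall] using h1 : ∃ i, i ∉ T))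
  rw [tendsto_zero_iff_abs_tendsto_zero]
  -- The factor 2 collects two defects: one from the steps that leave the chamber, one from
  -- replacing the denominator `numBallot k (n + 1)` by `k * numBallot k n`.
  refine tendsto_zero_of_le_mul_add (θ := |(k : ℝ) - 2 * T.card| / k)
    (e := fun n => 2 / k * (k - numBallot k (n + 1) / numBallot k n)) (fun n => abs_nonneg _)
    (by positivity) ?_ (by simpa using (tendsto_numBallot_defect hk).const_mul (2 / (k : ℝ))) ?_
  · rw [div_lt_one hk', abs_lt]
    have a1 : (0 : ℝ) < T.card := by exact_mod_cast hT0
    have a2 : (T.card : ℝ) < k := by exact_mod_cast hT1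
    constructor <;> linarith
  · intro n
    have p0 := numBallot_pos hk n
    have p1 := numBallot_pos hk (n + 1)
    have hle := abs_ballotSum_parityChar_succ_sub_le T n
    have hsmall : |ballotSum (n + 1) (parityChar T)| ≤ numBallot k (n + 1) := by
      refine (abs_ballotSum_le _ _).trans (le_of_eq ?_)
      simp only [abs_parityChar]; rfl
    have hdef := numBallot_succ_le (k := k) n
    simp only [Function.comp_apply, abs_div, abs_of_pos p0, abs_of_pos p1]
    set x := ballotSum (n + 1) (parityChar T)
    set y := ballotSum n (parityChar T)
    set A := numBallot k n
    set B := numBallot k (n + 1)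
    set t := (k : ℝ) - 2 * T.card
    have h3 : |x| ≤ |t| * |y| + (k * A - B) := by
      have := abs_sub_abs_le_abs_sub x (t * y)
      rw [abs_mul] at this
      linarith
    have h4 : |x| / B * (k * A - B) ≤ k * A - B :=
      mul_le_of_le_one_left (by linarith) ((div_le_one p1).2 hsmall)
    have h5 : k * A * (|x| / B) ≤ |t| * |y| + 2 * (k * A - B) := by
      have : |x| / B * B = |x| := div_mul_cancel₀ _ p1.ne'
      linarith
    rw [mul_comm, ← le_div_iff₀ (mul_pos hk' p0)] at h5
    refine h5.trans (le_of_eq ?_)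
    field_simp

/-- The set of odd coordinates. -/
def oddCoords (c : Fin k → ℤ) : Finset (Fin k) := Finset.univ.filter fun i => Odd (c i)

/-- Fourier inversion on parities: the product of the factors `1 ± (-1) ^ c i`, with the minus sign
on `E`, is `2 ^ k` if all parities match `E` and 0 otherwise. -/
lemma indicator_oddCoords_eq (E : Finset (Fin k)) (c : Fin k → ℤ) :
    (if oddCoords c = E then (1 : ℝ) else 0) =
      ∑ T : Finset (Fin k), (1 / 2) ^ k * ((-1) ^ (T ∩ E).card * parityChar T c) := by
  have hg : ∀ T : Finset (Fin k), (-1 : ℝ) ^ (T ∩ E).card * parityChar T c =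
      ∏ i ∈ T, ((if i ∈ E then -1 else 1) * (-1) ^ c i) := by
    intro T
    rw [parityChar, Finset.prod_mul_distrib, Finset.prod_ite]
    simp [Finset.filter_mem_eq_inter]
  have h1 : ∀ i, 1 + (if i ∈ E then -1 else 1) * (-1 : ℝ) ^ c i =
      if (i ∈ oddCoords c ↔ i ∈ E) then 2 else 0 := by
    intro i
    rcases Int.even_or_odd (c i) with h | h
    · have h' := Int.not_odd_iff_even.2 h
      by_cases hE : i ∈ E <;> simp [oddCoords, h', hE, h.neg_one_zpow, one_add_one_eq_two]
    · by_cases hE : i ∈ E <;> simp [oddCoords, h, hE, h.neg_one_zpow, one_add_one_eq_two]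
  simp only [← Finset.mul_sum, hg]
  rw [← Finset.powerset_univ, ← Finset.prod_one_add, Finset.prod_congr rfl fun i _ => h1 i]
  split_ifs with h
  · simp [h]
  · rw [Finset.ext_iff, not_forall] at h
    obtain ⟨i, hi⟩ := h
    rw [Finset.prod_eq_zero (Finset.mem_univ i) (if_neg hi), mul_zero]

lemma ballotSum_parityChar_univ (n : ℕ) :
    ballotSum n (parityChar (Finset.univ : Finset (Fin k))) = (-1) ^ n * numBallot k n := by
  rw [numBallot, ← ballotSum_const_mul]
  refine ballotSum_congr n fun c _ _ hs => ?_
  have : ∀ s : Finset (Fin k), ∏ i ∈ s, (-1 : ℝ) ^ c i = (-1) ^ ∑ i ∈ s, c i := by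
    intro s
    induction s using Finset.cons_induction with
    | empty => simp
    | cons a s ha ih => rw [Finset.prod_cons, Finset.sum_cons, ih, zpow_add₀ (by norm_num)]
  rw [parityChar, this, hs]
  simp

/-- The number of ballot words of length `n` that have `j` letters of odd multiplicity. -/
def numBallotOdd (k n j : ℕ) : ℝ :=
  ballotSum (k := k) n fun c => if (oddCoords c).card = j then 1 else 0

theorem tendsto_numBallotOdd (hk : 1 ≤ k) (j : ℕ) :
    Tendsto (fun n => numBallotOdd k n j / numBallot k n -
      (1 / 2) ^ k * k.choose j * (1 + (-1) ^ (n + j))) atTop (nhds 0) := by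
  have hne : (∅ : Finset (Fin k)) ≠ Finset.univ := by
    have : Nonempty (Fin k) := ⟨⟨0, hk⟩⟩
    exact Finset.univ_nonempty.ne_empty.symm
  have hind : ∀ c : Fin k → ℤ, (if (oddCoords c).card = j then (1 : ℝ) else 0) =
      ∑ E ∈ Finset.powersetCard j Finset.univ, if oddCoords c = E then 1 else 0 := by
    intro c
    simp [Finset.mem_powersetCard]
  -- Only the trivial and the full character survive in the limit.
  have hchar : ∀ T : Finset (Fin k), Tendsto (fun n => ballotSum n (parityChar T) / numBallot k n -
      ((if T = ∅ then 1 else 0) + if T = Finset.univ then (-1) ^ n else 0)) atTop (nhds 0) := by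
    intro T
    by_cases h0 : T = ∅
    · subst h0
      refine tendsto_const_nhds.congr fun n => ?_
      have : ballotSum n (parityChar (∅ : Finset (Fin k))) = numBallot k n := by
        exact congrArg (ballotSum n) (funext fun c => Finset.prod_empty)
      rw [this, div_self (numBallot_pos hk n).ne', if_pos rfl, if_neg hne, add_zero,
        sub_self]
    by_cases h1 : T = Finset.univ
    · subst h1
      refine tendsto_const_nhds.congr fun n => ?_
      rw [ballotSum_parityChar_univ, mul_div_cancel_right₀ _ (numBallot_pos hk n).ne', if_neg h0,
        if_pos rfl, zero_add, sub_self]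
    · simpa [h0, h1] using tendsto_ballotSum_parityChar hk h0 h1
  have hlim : Tendsto (fun n => ∑ E ∈ Finset.powersetCard j (Finset.univ : Finset (Fin k)),
      ∑ T : Finset (Fin k), (1 / 2 : ℝ) ^ k * ((-1) ^ (T ∩ E).card *
        (ballotSum n (parityChar T) / numBallot k n -
          ((if T = ∅ then 1 else 0) + if T = Finset.univ then (-1) ^ n else 0)))) atTop
      (nhds (∑ E ∈ Finset.powersetCard j (Finset.univ : Finset (Fin k)),
        ∑ T : Finset (Fin k), (1 / 2 : ℝ) ^ k * ((-1) ^ (T ∩ E).card * 0))) :=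
    tendsto_finsetSum _ fun E _ => tendsto_finsetSum _ fun T _ =>
      ((hchar T).const_mul _).const_mul _
  simp only [mul_zero, Finset.sum_const_zero] at hlim
  refine hlim.congr fun n => ?_
  have e1 : numBallotOdd k n j = ∑ E ∈ Finset.powersetCard j (Finset.univ : Finset (Fin k)),
      ∑ T : Finset (Fin k), (1 / 2 : ℝ) ^ k * ((-1) ^ (T ∩ E).card *
        ballotSum n (parityChar T)) := by
    simp only [numBallotOdd, hind, ballotSum_finset_sum, indicator_oddCoords_eq,
      ballotSum_const_mul]
  have e2 : (1 / 2 : ℝ) ^ k * k.choose j * (1 + (-1) ^ (n + j)) =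
      ∑ E ∈ Finset.powersetCard j (Finset.univ : Finset (Fin k)),
      ∑ T : Finset (Fin k), (1 / 2 : ℝ) ^ k * ((-1) ^ (T ∩ E).card *
        ((if T = ∅ then 1 else 0) + if T = Finset.univ then (-1) ^ n else 0)) := by
    have : ∀ E ∈ Finset.powersetCard j (Finset.univ : Finset (Fin k)),
        ∑ T : Finset (Fin k), (1 / 2 : ℝ) ^ k * ((-1) ^ (T ∩ E).card *
        ((if T = ∅ then 1 else 0) + if T = Finset.univ then (-1) ^ n else 0)) =
        (1 / 2 : ℝ) ^ k * (1 + (-1) ^ (n + j)) := by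
      intro E hE
      rw [Finset.mem_powersetCard] at hE
      simp only [mul_add, Finset.sum_add_distrib, mul_ite, mul_one, mul_zero,
        Finset.sum_ite_eq', Finset.mem_univ, if_true]
      simp [hE.2, pow_add, mul_comm]
    rw [Finset.sum_congr rfl this]
    simp
    ring
  rw [e1, e2, Finset.sum_div, ← Finset.sum_sub_distrib]
  refine Finset.sum_congr rfl fun E _ => ?_
  rw [Finset.sum_div, ← Finset.sum_sub_distrib]
  refine Finset.sum_congr rfl fun T _ => ?_
  ring

end Chamber

/-! ### Growth diagrams

A growth diagram is encoded by the labels of its edges: an edge carries `some r` if the shapes at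
its ends differ by a box in row `r`, and `none` if they agree. -/

namespace Growth

open Classical in
/-- The local rule: the label that leaves a cell in the direction of the incoming label `v`, where
`h` is the other incoming label and `x` says whether the cell is marked. -/
def pass (v h : Option ℕ) (x : Prop) : Option ℕ :=
  if x then some 0 else if v = h then v.map (· + 1) else v

lemma pass_eq_none {v h : Option ℕ} {x : Prop} : pass v h x = none ↔ v = none ∧ ¬ x := by
  unfold pass
  split_ifs <;> simp_all

/-- The outgoing labels reveal the case: two `some 0` for a mark, equal labels that are `none` or
positive for equal incoming ones, distinct labels otherwise. As marks only occur where both incoming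
labels are `none`, nothing is lost. -/
lemma pass_injective {v h v' h' : Option ℕ} {x x' : Prop} (hx : x → v = none ∧ h = none)
    (hx' : x' → v' = none ∧ h' = none) (h1 : pass v h x = pass v' h' x')
    (h2 : pass h v x = pass h' v' x') : v = v' ∧ h = h' ∧ (x ↔ x') := by
  unfold pass at h1 h2
  by_cases hx0 : x <;> by_cases hx1 : x' <;>
    simp only [hx0, hx1, if_true, if_false, forall_const, false_imp_iff] at h1 h2 hx hx' ⊢ <;>
    rcases v with _ | v <;> rcases h with _ | h <;> rcases v' with _ | v' <;>
    rcases h' with _ | h' <;> grind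

/-- The inverse of the local rule. -/
def unpass (v h : Option ℕ) : Option ℕ :=
  if v = h then v.bind fun r => if r = 0 then none else some (r - 1) else v

lemma pass_unpass (v h : Option ℕ) :
    pass (unpass v h) (unpass h v) (v = some 0 ∧ h = some 0) = v := by
  unfold pass unpass
  rcases v with _ | _ | v <;> rcases h with _ | _ | h <;> grind

/-- The vertical labels of a row with horizontal labels `h` at the top and marks `x`. -/
def carry (h : ℕ → Option ℕ) (x : ℕ → Prop) : ℕ → Option ℕ
  | 0 => none
  | j + 1 => pass (carry h x j) (h j) (x j)

/-- The horizontal labels of the growth diagram of the marks `X`. -/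
def row (X : ℕ → ℕ → Prop) : ℕ → ℕ → Option ℕ
  | 0 => fun _ => none
  | i + 1 => fun j => pass (row X i j) (carry (row X i) (X i) j) (X i j)

/-- The vertical labels of the growth diagram of the marks `X`. -/
def col (X : ℕ → ℕ → Prop) (i : ℕ) : ℕ → Option ℕ := carry (row X i) (X i)

lemma col_succ (X : ℕ → ℕ → Prop) (i j : ℕ) :
    col X i (j + 1) = pass (col X i j) (row X i j) (X i j) := rfl

lemma row_succ (X : ℕ → ℕ → Prop) (i j : ℕ) :
    row X (i + 1) j = pass (row X i j) (col X i j) (X i j) := rfl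

lemma carry_congr {h h' : ℕ → Option ℕ} {x x' : ℕ → Prop} {j : ℕ}
    (hh : ∀ a < j, h a = h' a) (hx : ∀ a < j, (x a ↔ x' a)) : carry h x j = carry h' x' j := by
  induction j with
  | zero => rfl
  | succ j ih =>
    simp only [carry]
    rw [ih (fun a ha => hh a (by omega)) (fun a ha => hx a (by omega)), hh j (by omega),
      propext (hx j (by omega))]

lemma row_congr {X X' : ℕ → ℕ → Prop} {i j : ℕ}
    (hX : ∀ a < i, ∀ b ≤ j, (X a b ↔ X' a b)) : row X i j = row X' i j := by
  induction i generalizing j with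
  | zero => rfl
  | succ i ih =>
    simp only [row]
    rw [ih fun a ha b hb => hX a (by omega) b hb, propext (hX i (by omega) j le_rfl),
      carry_congr (h' := row X' i) (x' := X' i)
        (fun a ha => ih fun c hc b hb => hX c (by omega) b (by omega))
        (fun a ha => hX i (by omega) a (by omega))]

lemma carry_eq_none {h : ℕ → Option ℕ} {x : ℕ → Prop} {j : ℕ} :
    carry h x j = none ↔ ∀ a < j, ¬ x a := by
  induction j with
  | zero => simp [carry]
  | succ j ih =>
    simp only [carry, pass_eq_none, ih, Nat.lt_succ_iff_lt_or_eq]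
    constructor
    · rintro ⟨h1, h2⟩ a (ha | rfl)
      exacts [h1 a ha, h2]
    · exact fun h => ⟨fun a ha => h a (Or.inl ha), h j (Or.inr rfl)⟩

lemma row_eq_none {X : ℕ → ℕ → Prop} {i j : ℕ} : row X i j = none ↔ ∀ a < i, ¬ X a j := by
  induction i with
  | zero => simp [row]
  | succ i ih =>
    simp only [row, pass_eq_none, ih, Nat.lt_succ_iff_lt_or_eq]
    constructor
    · rintro ⟨h1, h2⟩ a (ha | rfl)
      exacts [h1 a ha, h2]
    · exact fun h => ⟨fun a ha => h a (Or.inl ha), h i (Or.inr rfl)⟩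

/-- The marks of a partial involution of `{0, …, n - 1}`. -/
structure IsPartialInvolution (X : ℕ → ℕ → Prop) (n : ℕ) : Prop where
  symm : ∀ {i j}, X i j → X j i
  lt : ∀ {i j}, X i j → i < n
  unique : ∀ {i j j'}, X i j → X i j' → j = j'

namespace IsPartialInvolution

variable {X : ℕ → ℕ → Prop} {n : ℕ}

lemma none_of_mark (hX : IsPartialInvolution X n) {i j : ℕ} (h : X i j) :
    col X i j = none ∧ row X i j = none := by
  refine ⟨carry_eq_none.2 fun a ha h' => ?_, row_eq_none.2 fun a ha h' => ?_⟩
  · exact ha.ne (hX.unique h' h)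
  · exact ha.ne (hX.unique (hX.symm h') (hX.symm h))

/-- The local rule treats both directions alike, so symmetric marks give a symmetric diagram. -/
lemma col_eq_row (hX : IsPartialInvolution X n) (i j : ℕ) : col X i j = row X j i := by
  induction hs : i + j using Nat.strong_induction_on generalizing i j with
  | _ s ih =>
    cases j with
    | zero => rfl
    | succ j =>
      rw [col_succ, row_succ, ih (i + j) (by omega) i j rfl, ih (j + i) (by omega) j i rfl,
        propext ⟨hX.symm, hX.symm⟩]

end IsPartialInvolution

/-! ### Shapes at the corners of a growth diagram -/

/-- The two paths around a cell carry the same labels up to order, so the shape at a corner does not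
depend on the path leading to it. -/
lemma pass_add {M : Type*} [AddCommMonoid M] {f : Option ℕ → M}
    {v h : Option ℕ} {x : Prop} (hx : x → v = none ∧ h = none) :
    f h + f (pass v h x) = f v + f (pass h v x) := by
  unfold pass
  by_cases hx0 : x
  · simp [hx0, (hx hx0).1, (hx hx0).2]
  · by_cases hvh : v = h
    · simp [hvh]
    · simp [hx0, hvh, Ne.symm hvh, add_comm]

lemma sum_add_carry {M : Type*} [AddCommMonoid M] {f : Option ℕ → M} (hf : f none = 0)
    {h w : ℕ → Option ℕ} {x : ℕ → Prop} {j : ℕ}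
    (hx : ∀ a < j, x a → carry h x a = none ∧ h a = none)
    (hw : ∀ a < j, w a = pass (h a) (carry h x a) (x a)) :
    ∑ a ∈ Finset.range j, f (w a) = ∑ a ∈ Finset.range j, f (h a) + f (carry h x j) := by
  induction j with
  | zero => simp [carry, hf]
  | succ j ih =>
    rw [Finset.sum_range_succ, Finset.sum_range_succ,
      ih (fun a ha => hx a (by omega)) (fun a ha => hw a (by omega)), add_assoc, add_assoc,
      hw j (by omega), carry, pass_add (hx j (by omega))]

/-- The number of occurrences of a letter among the first `j` letters of a word. -/
def cnt {α : Type*} [DecidableEq α] (w : ℕ → α) (j : ℕ) (a : α) : ℕ :=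
  ∑ b ∈ Finset.range j, if w b = a then 1 else 0

lemma cnt_succ {α : Type*} [DecidableEq α] (w : ℕ → α) (j : ℕ) (a : α) :
    cnt w (j + 1) a = cnt w j a + if w j = a then 1 else 0 :=
  Finset.sum_range_succ ..

lemma cnt_zero {α : Type*} [DecidableEq α] (w : ℕ → α) (a : α) : cnt w 0 a = 0 := rfl

lemma cnt_congr {α : Type*} [DecidableEq α] {w w' : ℕ → α} {j : ℕ} (h : ∀ b < j, w b = w' b)
    (a : α) : cnt w j a = cnt w' j a :=
  Finset.sum_congr rfl fun b hb => by rw [h b (Finset.mem_range.1 hb)]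

lemma cnt_mono {α : Type*} [DecidableEq α] (w : ℕ → α) {i j : ℕ} (h : i ≤ j) (a : α) :
    cnt w i a ≤ cnt w j a :=
  Finset.sum_le_sum_of_subset (Finset.range_mono h)

lemma sum_row_succ {M : Type*} [AddCommMonoid M] {f : Option ℕ → M} (hf : f none = 0)
    {X : ℕ → ℕ → Prop} {n : ℕ} (hX : IsPartialInvolution X n) (i j : ℕ) :
    ∑ a ∈ Finset.range j, f (row X (i + 1) a) =
      ∑ a ∈ Finset.range j, f (row X i a) + f (col X i j) :=
  sum_add_carry hf (fun _ _ h => hX.none_of_mark h) fun _ _ => rfl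

/-- Here `cnt (row X i) j (some r)` is the length of row `r` of the shape at the corner `(i, j)`,
and `col X i j` names the box gained by moving to `(i + 1, j)`. -/
lemma cnt_row_succ {X : ℕ → ℕ → Prop} {n : ℕ} (hX : IsPartialInvolution X n) (i j r : ℕ) :
    cnt (row X (i + 1)) j (some r) =
      cnt (row X i) j (some r) + if col X i j = some r then 1 else 0 :=
  sum_row_succ (f := fun o : Option ℕ => if o = some r then 1 else 0) (by simp) hX i j

/-- In the first `n` prefixes of `w`, the label `r` is at least as frequent as `r + 1`. -/
def BallotTo (w : ℕ → Option ℕ) (n : ℕ) : Prop :=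
  ∀ j ≤ n, ∀ r, cnt w j (some (r + 1)) ≤ cnt w j (some r)

/-- Shapes remain partitions across a cell. If both incoming labels are `r`, row `r` has just grown
and leaves room in row `r + 1`; if they differ, the new shape is the union of two partitions. -/
lemma ballotTo_row {X : ℕ → ℕ → Prop} {n : ℕ} (hX : IsPartialInvolution X n) (i m : ℕ) :
    BallotTo (row X i) m := by
  suffices ∀ j r, cnt (row X i) j (some (r + 1)) ≤ cnt (row X i) j (some r) from
    fun j _ r => this j r
  induction i with
  | zero => intro j r; simp [cnt, row]
  | succ i ihi =>
    intro j r
    induction j with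
    | zero => simp [cnt]
    | succ j ihj =>
      have h1 := ihi j r
      have h2 := ihi (j + 1) r
      have hm := fun h : X i j => hX.none_of_mark h
      have he := row_succ X i j
      simp only [cnt_succ, cnt_row_succ hX] at h1 h2 ihj ⊢
      generalize row X (i + 1) j = u at *
      generalize row X i j = h at *
      generalize col X i j = v at *
      unfold pass at he
      subst he
      clear ihi
      rcases h with _ | h <;> rcases v with _ | v <;> by_cases hx : X i j <;> simp_all <;> grind

/-! #### Longest increasing chains -/

/-- A strictly increasing chain of marks in the rows below `i` and the columns below `j`. -/
def IsIncChain (X : ℕ → ℕ → Prop) (i j : ℕ) (s : Finset (ℕ × ℕ)) : Prop :=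
  (∀ a ∈ s, a.1 < i ∧ a.2 < j ∧ X a.1 a.2) ∧ ∀ a ∈ s, ∀ b ∈ s, a.1 < b.1 → a.2 < b.2

/-- If the corner cell is marked, it is the only mark in its row and column, and erasing it costs at
most one. Otherwise a chain that meets the last row misses the last column. -/
lemma IsIncChain.card_le {X : ℕ → ℕ → Prop} {n : ℕ} (hX : IsPartialInvolution X n) {i j : ℕ}
    {s : Finset (ℕ × ℕ)} (hs : IsIncChain X i j s) : s.card ≤ cnt (row X i) j (some 0) := by
  induction i generalizing j s with
  | zero =>
    have : s = ∅ := Finset.eq_empty_of_forall_notMem fun a ha => by simpa using (hs.1 a ha).1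
    simp [this]
  | succ i ihi =>
    induction j generalizing s with
    | zero =>
      have : s = ∅ := Finset.eq_empty_of_forall_notMem fun a ha => by simpa using (hs.1 a ha).2.1
      simp [this]
    | succ j ihj =>
      by_cases hx : X i j
      · have h1 : IsIncChain X i j (s.erase (i, j)) := by
          refine ⟨fun a ha => ?_, fun a ha b hb => hs.2 a (Finset.mem_of_mem_erase ha) b
            (Finset.mem_of_mem_erase hb)⟩
          obtain ⟨hne, ha⟩ := Finset.mem_erase.1 ha
          obtain ⟨a1, a2, a3⟩ := hs.1 a ha
          have n1 : a.1 ≠ i := fun h => hne (Prod.ext h (hX.unique (h ▸ a3) hx))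
          have n2 : a.2 ≠ j := fun h =>
            hne (Prod.ext (hX.unique (hX.symm (h ▸ a3)) (hX.symm hx)) h)
          exact ⟨by omega, by omega, a3⟩
        have h2 := ihi h1
        have h3 := Finset.pred_card_le_card_erase (s := s) (a := (i, j))
        have e1 := (hX.none_of_mark hx).1
        have h4 : cnt (row X (i + 1)) (j + 1) (some 0) = cnt (row X i) j (some 0) + 1 := by
          simp [cnt_succ, cnt_row_succ hX, row_succ, e1, pass, hx]
        omega
      · by_cases hr : ∃ b, (i, b) ∈ s
        · obtain ⟨b, hb⟩ := hr
          have h1 : IsIncChain X (i + 1) j s := by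
            refine ⟨fun a ha => ?_, hs.2⟩
            obtain ⟨a1, a2, a3⟩ := hs.1 a ha
            refine ⟨a1, ?_, a3⟩
            obtain ⟨-, b2, b3⟩ := hs.1 _ hb
            rcases Nat.lt_succ_iff_lt_or_eq.1 a1 with h | h
            · have := hs.2 a ha _ hb h
              simp only at this b2
              omega
            · have : a.2 ≠ j := fun h' => hx (h' ▸ h ▸ a3)
              omega
          exact (ihj h1).trans (cnt_mono _ (Nat.le_succ j) _)
        · have h1 : IsIncChain X i (j + 1) s := by
            refine ⟨fun a ha => ?_, hs.2⟩
            obtain ⟨a1, a2, a3⟩ := hs.1 a ha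
            have : a.1 ≠ i := fun h => hr ⟨a.2, by rw [← h]; exact ha⟩
            exact ⟨by omega, a2, a3⟩
          exact (ihi h1).trans (by rw [cnt_row_succ hX]; exact Nat.le_add_right _ _)

/-- Across a marked cell the first row grows by one, and the mark extends the chain. Across an
unmarked one it is as long as at one of the two adjacent corners, whose chain is reused. -/
lemma exists_isIncChain {X : ℕ → ℕ → Prop} {n : ℕ} (hX : IsPartialInvolution X n) (i j : ℕ) :
    ∃ s, IsIncChain X i j s ∧ s.card = cnt (row X i) j (some 0) := by
  induction i generalizing j with
  | zero => exact ⟨∅, by simp [IsIncChain], by simp [cnt, row]⟩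
  | succ i ihi =>
    induction j with
    | zero => exact ⟨∅, by simp [IsIncChain], by simp [cnt]⟩
    | succ j ihj =>
      by_cases hx : X i j
      · obtain ⟨s, hs, hc⟩ := ihi j
        have hn : (i, j) ∉ s := fun h => by simpa using (hs.1 _ h).1
        refine ⟨insert (i, j) s, ⟨?_, ?_⟩, ?_⟩
        · intro a ha
          rcases Finset.mem_insert.1 ha with rfl | ha
          · exact ⟨by simp, by simp, hx⟩
          · obtain ⟨a1, a2, a3⟩ := hs.1 a ha
            exact ⟨by omega, by omega, a3⟩
        · intro a ha b hb hab
          rcases Finset.mem_insert.1 ha with rfl | ha <;>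
            rcases Finset.mem_insert.1 hb with rfl | hb
          · simp at hab
          · have := (hs.1 b hb).1
            simp only at hab
            omega
          · exact (hs.1 a ha).2.1
          · exact hs.2 a ha b hb hab
        · have e1 := (hX.none_of_mark hx).1
          rw [Finset.card_insert_of_notMem hn, hc]
          simp [cnt_succ, cnt_row_succ hX, row_succ, e1, pass, hx]
      · by_cases hh : row X i j = some 0 ∧ col X i j ≠ some 0
        · obtain ⟨s, hs, hc⟩ := ihi (j + 1)
          refine ⟨s, ⟨fun a ha => ?_, hs.2⟩, ?_⟩
          · obtain ⟨a1, a2, a3⟩ := hs.1 a ha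
            exact ⟨by omega, a2, a3⟩
          · rw [hc]
            simp [cnt_succ, cnt_row_succ hX, row_succ, hh.1, hh.2, pass, hx, Ne.symm hh.2]
        · obtain ⟨s, hs, hc⟩ := ihj
          refine ⟨s, ⟨fun a ha => ?_, hs.2⟩, ?_⟩
          · obtain ⟨a1, a2, a3⟩ := hs.1 a ha
            exact ⟨a1, by omega, a3⟩
          · have : row X (i + 1) j ≠ some 0 := by
              rw [row_succ]
              unfold pass
              generalize row X i j = h at *
              generalize col X i j = v at *
              rcases h with _ | h <;> rcases v with _ | v <;> grind
            rw [hc, cnt_succ, if_neg this, add_zero]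

/-! #### Fixed points -/

/-- The sign of the row of a label. -/
def labelSign : Option ℕ → ℤ
  | none => 0
  | some r => (-1) ^ r

open Classical in
-- The alternating sum of the row lengths counts the columns of odd length. A diagonal cell has
-- equal incoming labels: a label `r` contributes `(-1)^r + (-1)^(r+1) = 0`, and without labels only
-- a mark contributes, by a box in row 0.
lemma sum_labelSign_row {X : ℕ → ℕ → Prop} {n : ℕ} (hX : IsPartialInvolution X n) (m : ℕ) :
    ∑ a ∈ Finset.range m, labelSign (row X m a) =
      ∑ a ∈ Finset.range m, if X a a then 1 else 0 := by
  induction m with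
  | zero => simp
  | succ m ih =>
    rw [Finset.sum_range_succ, sum_row_succ rfl hX, ih, Finset.sum_range_succ, add_assoc, row_succ,
      hX.col_eq_row]
    congr 1
    by_cases hx : X m m
    · simp [(hX.none_of_mark hx).2, pass, hx, labelSign]
    · rcases row X m m with _ | r
      · simp [pass, hx, labelSign]
      · simp [pass, hx, labelSign, pow_succ]

/-! #### Bijectivity -/

/-- By symmetry the last vertical label equals the last horizontal one. So all outgoing labels of
the final strip are known, and `pass_injective` recovers the strip from right to left. -/
lemma marks_eq_of_row_eq {X X' : ℕ → ℕ → Prop} {n n' m : ℕ} (hX : IsPartialInvolution X n)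
    (hX' : IsPartialInvolution X' n') (h : ∀ j < m, row X m j = row X' m j) :
    ∀ i < m, ∀ j < m, (X i j ↔ X' i j) := by
  induction m with
  | zero => intro i hi; omega
  | succ m ih =>
    have cell : ∀ j ≤ m, col X m (j + 1) = col X' m (j + 1) →
        col X m j = col X' m j ∧ row X m j = row X' m j ∧ (X m j ↔ X' m j) := fun j hj hc =>
      pass_injective hX.none_of_mark hX'.none_of_mark hc (h j (by omega))
    have hlast : col X m (m + 1) = col X' m (m + 1) := by
      have := h m (by omega)
      rw [row_succ, row_succ, ← hX.col_eq_row, ← hX'.col_eq_row] at this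
      rw [col_succ, col_succ, ← hX.col_eq_row, ← hX'.col_eq_row]
      exact this
    have hall : ∀ d ≤ m, col X m (m + 1 - d) = col X' m (m + 1 - d) := by
      intro d hd
      induction d with
      | zero => exact hlast
      | succ d ihd =>
        have h1 := ihd (by omega)
        rw [show m + 1 - d = (m + 1 - (d + 1)) + 1 by omega] at h1
        exact (cell _ (by omega) h1).1
    have hcell : ∀ j ≤ m, col X m j = col X' m j ∧ row X m j = row X' m j ∧ (X m j ↔ X' m j) := by
      intro j hj
      refine cell j hj ?_
      have := hall (m - j) (by omega)
      rwa [show m + 1 - (m - j) = j + 1 by omega] at this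
    have ih' := ih fun j hj => (hcell j hj.le).2.1
    intro i hi j hj
    rcases Nat.lt_succ_iff_lt_or_eq.1 hi with hi | rfl
    · rcases Nat.lt_succ_iff_lt_or_eq.1 hj with hj | rfl
      · exact ih' i hi j hj
      · have := (hcell i hi.le).2.2
        exact ⟨fun h => hX'.symm (this.1 (hX.symm h)), fun h => hX.symm (this.2 (hX'.symm h))⟩
    · exact (hcell j (by omega)).2.2

/-- Removing a box in the row given by the label `v` from the shape of the first `j` letters of `w`
leaves a shape. -/
def Removable (w : ℕ → Option ℕ) (j : ℕ) (v : Option ℕ) : Prop :=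
  ∀ r, (if v = some r then 1 else 0) ≤ cnt w j (some r) ∧
    cnt w j (some (r + 1)) + (if v = some r then 1 else 0) ≤
      cnt w j (some r) + if v = some (r + 1) then 1 else 0

/-- If both outgoing labels are `some (r + 1)`, taking a box from row `r + 1` makes one in row `r`
removable. -/
lemma Removable.unpass {w : ℕ → Option ℕ} {j : ℕ} {v : Option ℕ} (hw : BallotTo w (j + 1))
    (h : Removable w (j + 1) v) : Removable w j (unpass v (w j)) := by
  intro r
  have a1 := hw j (by omega) r
  have a2 := hw (j + 1) le_rfl r
  have h1 := h r
  have h2 := h (r + 1)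
  simp only [cnt_succ] at a2 h1 h2
  generalize w j = u at *
  unfold Growth.unpass
  rcases u with _ | _ | u <;> rcases v with _ | _ | v <;> simp_all <;> grind

/-- Reversing a row of a growth diagram. -/
lemma exists_row_of_ballotTo {w : ℕ → Option ℕ} {j : ℕ} {v : Option ℕ} (hw : BallotTo w j)
    (hv : Removable w j v) : ∃ (h : ℕ → Option ℕ) (x : ℕ → Prop), carry h x j = v ∧
      (∀ a < j, w a = pass (h a) (carry h x a) (x a)) ∧
      (∀ a < j, x a → carry h x a = none ∧ h a = none) ∧ BallotTo h j := by
  induction j generalizing v with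
  | zero =>
    refine ⟨fun _ => none, fun _ => False, ?_, by simp, by simp, ?_⟩
    · rcases v with _ | r
      · rfl
      · have := (hv r).1
        simp [cnt_zero] at this
    · intro j _ r; simp [cnt]
  | succ j ih =>
    obtain ⟨h, x, hc, hp, hx, hb⟩ := ih (fun i hi => hw i (by omega)) (hv.unpass hw)
    have hh : ∀ a < j, Function.update h j (unpass (w j) v) a = h a := fun a ha =>
      Function.update_of_ne ha.ne _ _
    have hxx : ∀ a < j, (Function.update x j (v = some 0 ∧ w j = some 0) a ↔ x a) := fun a ha => by
      rw [Function.update_of_ne ha.ne]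
    have hcc : ∀ a ≤ j, carry (Function.update h j (unpass (w j) v))
        (Function.update x j (v = some 0 ∧ w j = some 0)) a = carry h x a := fun a ha =>
      carry_congr (fun b hb => hh b (by omega)) fun b hb => hxx b (by omega)
    have hcv : carry (Function.update h j (unpass (w j) v))
        (Function.update x j (v = some 0 ∧ w j = some 0)) (j + 1) = v := by
      simp only [carry]
      rw [hcc j le_rfl, hc, Function.update_self, Function.update_self, pass_unpass]
    have hpp : ∀ a < j + 1, w a = pass (Function.update h j (unpass (w j) v) a)
        (carry (Function.update h j (unpass (w j) v))
          (Function.update x j (v = some 0 ∧ w j = some 0)) a)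
        (Function.update x j (v = some 0 ∧ w j = some 0) a) := by
      intro a ha
      rcases Nat.lt_succ_iff_lt_or_eq.1 ha with ha | rfl
      · rw [hcc a ha.le, hh a ha, propext (hxx a ha)]
        exact hp a ha
      · rw [hcc a le_rfl, hc, Function.update_self, Function.update_self, and_comm, pass_unpass]
    have hxn : ∀ a < j + 1, Function.update x j (v = some 0 ∧ w j = some 0) a →
        carry (Function.update h j (unpass (w j) v))
          (Function.update x j (v = some 0 ∧ w j = some 0)) a = none ∧
        Function.update h j (unpass (w j) v) a = none := by
      intro a ha hxa
      rcases Nat.lt_succ_iff_lt_or_eq.1 ha with ha | rfl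
      · rw [hcc a ha.le, hh a ha]
        exact hx a ha ((hxx a ha).1 hxa)
      · rw [Function.update_self] at hxa
        rw [hcc a le_rfl, hc, Function.update_self, hxa.1, hxa.2]
        simp [unpass]
    refine ⟨_, _, hcv, hpp, hxn, ?_⟩
    intro i hi r
    rcases Nat.le_succ_iff.1 hi with hi | rfl
    · rw [cnt_congr fun b hb => hh b (by omega), cnt_congr fun b hb => hh b (by omega)]
      exact hb i hi r
    -- The new shape is that of `w` without the box of `v`, so removability is its ballot condition.
    · have key : ∀ r, cnt w (j + 1) (some r) =
          cnt (Function.update h j (unpass (w j) v)) (j + 1) (some r) +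
            if v = some r then 1 else 0 := fun r => by
        have := sum_add_carry (f := fun o : Option ℕ => if o = some r then 1 else 0) (by simp)
          hxn hpp
        rw [hcv] at this
        exact this
      have h1 := (hv r).2
      rw [key r, key (r + 1)] at h1
      rw [Nat.succ_eq_add_one]
      omega

/-- Every ballot word is the last row of a growth diagram. -/
lemma exists_marks_of_ballotTo {w : ℕ → Option ℕ} {n : ℕ} (hw : BallotTo w n) :
    ∃ X, IsPartialInvolution X n ∧ ∀ j < n, row X n j = w j := by
  induction n generalizing w with
  | zero => exact ⟨fun _ _ => False, ⟨by simp, by simp, by simp⟩, by simp⟩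
  | succ n ih =>
    -- Symmetry forces the vertical label at the right end of the last strip to be the last letter
    -- `w n`.
    have hv : Removable w (n + 1) (w n) := by
      intro r
      have := hw n (by omega) r
      simp only [cnt_succ]
      omega
    obtain ⟨h, x, hc, hp, hx, hb⟩ := exists_row_of_ballotTo hw hv
    -- The corner cell emits equal labels, so exchanging its two directions changes nothing and
    -- injectivity makes the incoming labels equal.
    have hd : carry h x n = h n := by
      have h1 := hp n (by omega)
      have h2 := hc
      simp only [carry] at h2
      exact (pass_injective (hx n (by omega)) (fun t => (hx n (by omega) t).symm)
        (h2.trans h1) (h1.symm.trans h2.symm)).1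
    obtain ⟨Y, hY, hr⟩ := ih fun i hi => hb i (by omega)
    have hYlt : ∀ {i j}, Y i j → i < n ∧ j < n := fun h => ⟨hY.lt h, hY.lt (hY.symm h)⟩
    have hYx : ∀ {i j}, Y i j → ¬ x j := fun {i j} h t => by
      have h1 := (hx j (by have := (hYlt h).2; omega) t).2
      rw [← hr j (hYlt h).2] at h1
      exact row_eq_none.1 h1 i (hYlt h).1 h
    have hxu : ∀ {i j}, i ≤ n → j ≤ n → x i → x j → i = j := by
      intro i j hi hj xi xj
      rcases lt_trichotomy i j with h' | h' | h'
      · exact absurd xi (carry_eq_none.1 (hx j (by omega) xj).1 i h')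
      · exact h'
      · exact absurd xj (carry_eq_none.1 (hx i (by omega) xi).1 j h')
    -- The smaller diagram is bordered by the marks `x` in row `n` and their mirror image in column
    -- `n`.
    have hX : IsPartialInvolution
        (fun i j => Y i j ∨ (i = n ∧ j ≤ n ∧ x j) ∨ (j = n ∧ i ≤ n ∧ x i)) (n + 1) := by
      refine ⟨?_, ?_, ?_⟩
      · rintro i j (h | h | h)
        exacts [Or.inl (hY.symm h), Or.inr (Or.inr h), Or.inr (Or.inl h)]
      · rintro i j (h | h | h)
        · exact (hYlt h).1.trans (Nat.lt_succ_self n)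
        · omega
        · omega
      · rintro i j j' (h | ⟨h, h1, h2⟩ | ⟨h, h1, h2⟩) (h' | ⟨h', h1', h2'⟩ | ⟨h', h1', h2'⟩)
        · exact hY.unique h h'
        · have := (hYlt h).1; omega
        · exact absurd h2' (hYx (hY.symm h))
        · have := (hYlt h').1; omega
        · exact hxu h1 h1' h2 h2'
        · exact (hxu h1 h1' h2 h2').trans (h'.symm ▸ h)
        · exact absurd h2 (hYx (hY.symm h'))
        · exact h.trans (h'.symm.trans (hxu h1 h1' h2 h2'))
        · exact h.trans h'.symm
    refine ⟨_, hX, ?_⟩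
    set X : ℕ → ℕ → Prop :=
      fun i j => Y i j ∨ (i = n ∧ j ≤ n ∧ x j) ∨ (j = n ∧ i ≤ n ∧ x i) with hXdef
    have hXx : ∀ j ≤ n, (X n j ↔ x j) := by
      intro j hj
      constructor
      · rintro (h | h | ⟨rfl, -, h⟩)
        · exact absurd (hYlt h).1 (lt_irrefl n)
        · exact h.2.2
        · exact h
      · exact fun h => Or.inr (Or.inl ⟨rfl, hj, h⟩)
    have hrow : ∀ j < n, row X n j = h j := by
      intro j hj
      rw [← hr j hj]
      refine row_congr fun a ha b hb => ?_
      constructor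
      · rintro (h | h | h)
        · exact h
        · omega
        · omega
      · exact Or.inl
    have hcol : ∀ j ≤ n, col X n j = carry h x j := fun j hj =>
      carry_congr (fun a ha => hrow a (by omega)) fun a ha => hXx a (by omega)
    have hrow' : ∀ j ≤ n, row X n j = h j := by
      intro j hj
      rcases hj.lt_or_eq with hj | rfl
      · exact hrow j hj
      · rw [← hX.col_eq_row, hcol j le_rfl, hd]
    intro j hj
    rw [row_succ, hrow' j (by omega), hcol j (by omega), propext (hXx j (by omega))]
    exact (hp j hj).symm

/-! #### Conjugation of ballot words -/

/-- In the first `n` prefixes of `w`, the letter `r` is at least as frequent as `r + 1`. -/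
def NatBallotTo (w : ℕ → ℕ) (n : ℕ) : Prop :=
  ∀ j ≤ n, ∀ r, cnt w j (r + 1) ≤ cnt w j r

lemma NatBallotTo.antitone {w : ℕ → ℕ} {n j : ℕ} (hw : NatBallotTo w n) (hj : j ≤ n) :
    Antitone (cnt w j) :=
  antitone_nat_of_succ_le (hw j hj)

/-- The conjugate of a word: a letter is replaced by the number of its previous occurrences. -/
def conj (w : ℕ → ℕ) (j : ℕ) : ℕ := cnt w j (w j)

lemma conj_congr {w w' : ℕ → ℕ} {n : ℕ} (h : ∀ j < n, w j = w' j) {j : ℕ} (hj : j < n) :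
    conj w j = conj w' j := by
  rw [conj, conj, h j hj, cnt_congr fun b hb => h b (hb.trans hj)]

/-- In tableau terms a letter is the row of a box and its conjugate the column. The hypothesis `h`
says that the shapes are transposes; a new box then lies in the row given by the previous height of
its column. -/
lemma cnt_conj_of_lt_cnt_iff {w : ℕ → ℕ} {j : ℕ}
    (h : ∀ r i, i < cnt w j r ↔ r < cnt (conj w) j i)
    (hw : ∀ r, cnt w (j + 1) (r + 1) ≤ cnt w (j + 1) r) :
    cnt (conj w) j (conj w j) = w j := by
  apply le_antisymm
  · by_contra hlt
    exact lt_irrefl _ ((h (w j) (conj w j)).2 (not_le.1 hlt))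
  · rcases hr : w j with _ | r
    · exact Nat.zero_le _
    · have h1 := hw r
      rw [cnt_succ, cnt_succ, if_pos hr, if_neg (by omega)] at h1
      refine Nat.succ_le_of_lt ((h r (conj w j)).1 ?_)
      rw [conj, hr]
      omega

lemma lt_cnt_iff_lt_cnt_conj {w : ℕ → ℕ} {n : ℕ} (hw : NatBallotTo w n) {j : ℕ} (hj : j ≤ n)
    (r i : ℕ) : i < cnt w j r ↔ r < cnt (conj w) j i := by
  induction j generalizing r i with
  | zero => simp [cnt_zero]
  | succ j ih =>
    have ih' := fun r i => ih (by omega) r i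
    have hs := cnt_conj_of_lt_cnt_iff ih' (hw (j + 1) hj)
    have hb : conj w j = cnt w j (w j) := rfl
    have h1 := ih' r i
    rw [cnt_succ, cnt_succ]
    rcases eq_or_ne (w j) r with hr | hr <;> rcases eq_or_ne (conj w j) i with hi | hi
    · rw [if_pos hr, if_pos hi, ← hi, hs, hb, hr]; omega
    · rw [if_pos hr, if_neg hi, ← hr, add_zero, ← ih' (w j) i]; omega
    · rw [if_neg hr, if_pos hi, add_zero, h1, ← hi, hs]; omega
    · rw [if_neg hr, if_neg hi]; exact h1

lemma conj_conj {w : ℕ → ℕ} {n : ℕ} (hw : NatBallotTo w n) {j : ℕ} (hj : j < n) :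
    conj (conj w) j = w j :=
  cnt_conj_of_lt_cnt_iff (lt_cnt_iff_lt_cnt_conj hw hj.le) (hw (j + 1) hj)

lemma NatBallotTo.conj {w : ℕ → ℕ} {n : ℕ} (hw : NatBallotTo w n) :
    NatBallotTo (conj w) n := by
  intro j hj i
  by_contra h
  have h1 := (lt_cnt_iff_lt_cnt_conj hw hj _ _).2 (not_le.1 h)
  exact lt_irrefl _ ((lt_cnt_iff_lt_cnt_conj hw hj _ _).1 ((Nat.lt_succ_self i).trans h1))

lemma exists_of_cnt_pos {w : ℕ → ℕ} {j r : ℕ} (h : 0 < cnt w j r) : ∃ b < j, w b = r := by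
  by_contra hne
  push Not at hne
  refine h.ne' (Finset.sum_eq_zero fun b hb => ?_)
  rw [if_neg (hne b (Finset.mem_range.1 hb))]

/-- The number of letters of odd multiplicity, in terms of the conjugate word. -/
lemma card_odd_cnt {w : ℕ → ℕ} {k n : ℕ} (hk : ∀ j < n, w j < k) :
    (((Finset.range k).filter fun i => Odd (cnt w n i)).card : ℤ) =
      ∑ j ∈ Finset.range n, (-1) ^ conj w j := by
  rw [Finset.card_filter]
  push_cast
  induction n with
  | zero => simp [cnt_zero]
  | succ n ih =>
    rw [Finset.sum_range_succ, ← ih fun j hj => hk j (by omega), ← sub_eq_iff_eq_add',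
      ← Finset.sum_sub_distrib, Finset.sum_eq_single (w n)]
    -- The last letter, seen `conj w n` times before, flips the parity of its own multiplicity.
    · rw [cnt_succ, if_pos rfl, conj]
      rcases Nat.even_or_odd (cnt w n (w n)) with h | h
      · simp [h, h.add_one, Nat.not_odd_iff_even.2 h]
      · simp [h, h.neg_one_pow, Nat.not_odd_iff_even.2 h.add_one]
    · intro i _ hi
      rw [cnt_succ, if_neg hi.symm, add_zero, sub_self]
    · intro h
      exact absurd (Finset.mem_range.2 (hk n (by omega))) h

/-! #### Words over a finite alphabet -/

/-- The extension of a finite word by zeros. -/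
def ext {n k : ℕ} (w : Fin n → Fin k) (j : ℕ) : ℕ := if h : j < n then w ⟨j, h⟩ else 0

lemma ext_val {n k : ℕ} (w : Fin n → Fin k) (j : Fin n) : ext w j = w j := by simp [ext]

lemma ext_lt {n k : ℕ} (w : Fin n → Fin k) {j : ℕ} (hj : j < n) : ext w j < k := by
  simp [ext, hj]

lemma prefixCount_eq_cnt {n k : ℕ} (w : Fin n → Fin k) {m : ℕ} (hm : m ≤ n) (i : Fin k) :
    Chamber.prefixCount w m i = cnt (ext w) m i := by
  have h1 : Chamber.prefixCount w m i =
      ∑ j : Fin n, if (j : ℕ) < m ∧ ext w j = i then (1 : ℤ) else 0 := by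
    refine Finset.sum_congr rfl fun j _ => ?_
    simp only [ext_val, Fin.val_inj]
  rw [h1, Fin.sum_univ_eq_sum_range (fun j => if j < m ∧ ext w j = i then (1 : ℤ) else 0), cnt]
  push_cast
  refine (Finset.sum_subset_zero_on_sdiff (Finset.range_mono hm) ?_ ?_).symm
  · intro b hb
    rw [if_neg]
    simp only [Finset.mem_sdiff, Finset.mem_range] at hb
    exact fun h => hb.2 h.1
  · intro b hb
    simp [Finset.mem_range.1 hb]

lemma isBallot_iff {n k : ℕ} (w : Fin n → Fin k) :
    Chamber.IsBallot w ↔ NatBallotTo (ext w) n := by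
  constructor
  · intro h j hj r
    rcases lt_or_ge (r + 1) k with hr | hr
    · have := h j (show (⟨r, by omega⟩ : Fin k) ≤ ⟨r + 1, hr⟩ from Nat.le_succ r)
      rw [prefixCount_eq_cnt w hj, prefixCount_eq_cnt w hj] at this
      exact_mod_cast this
    · rcases Nat.eq_zero_or_pos (cnt (ext w) j (r + 1)) with h0 | h0
      · omega
      · obtain ⟨b, hb, hb'⟩ := exists_of_cnt_pos h0
        have := ext_lt w (hb.trans_le hj)
        omega
  · intro h
    have key : ∀ m ≤ n, Antitone (Chamber.prefixCount w m) := by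
      intro m hm a b hab
      rw [prefixCount_eq_cnt w hm, prefixCount_eq_cnt w hm]
      exact_mod_cast h.antitone hm hab
    intro m
    rcases le_total m n with hm | hm
    · exact key m hm
    · rw [Chamber.prefixCount_of_le w hm]
      exact key n le_rfl

lemma card_oddCoords {n k : ℕ} (w : Fin n → Fin k) :
    ((Chamber.oddCoords (Chamber.prefixCount w n)).card : ℤ) =
      ∑ j ∈ Finset.range n, (-1) ^ conj (ext w) j := by
  rw [← card_odd_cnt fun j hj => ext_lt w hj, Chamber.oddCoords, Finset.card_filter,
    Finset.card_filter, ← Fin.sum_univ_eq_sum_range fun i => if Odd (cnt (ext w) n i) then 1 else 0]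
  simp only [prefixCount_eq_cnt w le_rfl, Int.odd_coe_nat]

/-! #### Involutions -/

/-- The marks of the permutation matrix of `π`. -/
def marks {n : ℕ} (π : Equiv.Perm (Fin n)) (i j : ℕ) : Prop := ∃ h : i < n, (π ⟨i, h⟩ : ℕ) = j

lemma marks_iff {n : ℕ} (π : Equiv.Perm (Fin n)) (i j : Fin n) : marks π i j ↔ π i = j := by
  simp [marks, Fin.ext_iff]

lemma marks_injective {n : ℕ} {π π' : Equiv.Perm (Fin n)}
    (h : ∀ i < n, ∀ j < n, (marks π i j ↔ marks π' i j)) : π = π' := by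
  ext1 i
  have := (h i i.2 (π i) (π i).2).1 ((marks_iff π i (π i)).2 rfl)
  exact ((marks_iff π' i (π i)).1 this).symm

lemma isPartialInvolution_marks {n : ℕ} {π : Equiv.Perm (Fin n)} (hπ : Function.Involutive π) :
    IsPartialInvolution (marks π) n where
  symm := by
    rintro i j ⟨h, rfl⟩
    exact (marks_iff π (π ⟨i, h⟩) ⟨i, h⟩).2 (hπ _)
  lt := fun ⟨h, _⟩ => h
  unique := by
    rintro i j j' ⟨h, rfl⟩ ⟨_, rfl⟩
    rfl

/-- An occurrence of the pattern is an increasing chain of `k + 1` marks, and the first row of the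
final shape measures the longest chain. -/
lemma containsPattern_iff {n : ℕ} (k : ℕ) {π : Equiv.Perm (Fin n)} (hπ : Function.Involutive π) :
    ContainsPattern π (increasingPattern k) ↔ k + 1 ≤ cnt (row (marks π) n) n (some 0) := by
  have hX := isPartialInvolution_marks hπ
  constructor
  · rintro ⟨f, hf, hfπ⟩
    have hmono : StrictMono fun a => π (f a) := fun a b hab => (hfπ a b hab).2 hab
    have hinj : Function.Injective fun a => ((f a : ℕ), (π (f a) : ℕ)) := fun a b h =>
      hf.injective (Fin.ext (Prod.ext_iff.1 h).1)
    have hs : IsIncChain (marks π) n n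
        (Finset.univ.image fun a => ((f a : ℕ), (π (f a) : ℕ))) := by
      constructor
      · intro p hp
        obtain ⟨a, -, rfl⟩ := Finset.mem_image.1 hp
        exact ⟨(f a).2, (π (f a)).2, (marks_iff π _ _).2 rfl⟩
      · intro p hp p' hp' h
        obtain ⟨a, -, rfl⟩ := Finset.mem_image.1 hp
        obtain ⟨b, -, rfl⟩ := Finset.mem_image.1 hp'
        exact hmono (hf.lt_iff_lt.1 h)
    simpa [Finset.card_image_of_injective _ hinj] using hs.card_le hX
  · intro h
    obtain ⟨s, hs, hc⟩ := exists_isIncChain hX n n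
    have hcard : s.card ≤ (Finset.univ.filter fun i : Fin n => ((i : ℕ), (π i : ℕ)) ∈ s).card := by
      refine (Finset.card_le_card (t := (Finset.univ.filter
        fun i : Fin n => ((i : ℕ), (π i : ℕ)) ∈ s).image fun i : Fin n => ((i : ℕ), (π i : ℕ)))
          ?_).trans Finset.card_image_le
      rintro ⟨i, j⟩ hp
      obtain ⟨-, -, hi, hij⟩ := hs.1 _ hp
      have hij' : (π ⟨i, hi⟩ : ℕ) = j := hij
      exact Finset.mem_image.2 ⟨⟨i, hi⟩, by simpa [hij'] using hp, by simp [hij']⟩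
    have hle := (hc ▸ h).trans hcard
    refine ⟨Finset.orderEmbOfCardLe _ hle, (Finset.orderEmbOfCardLe _ hle).strictMono, ?_⟩
    intro a b hab
    have hm := fun a => (Finset.mem_filter.1 (Finset.orderEmbOfCardLe_mem _ hle a)).2
    exact iff_of_true (hs.2 _ (hm a) _ (hm b) ((Finset.orderEmbOfCardLe _ hle).strictMono hab)) hab

/-- The involution `π` corresponds to the ballot word `w`: the last row of the growth diagram
of `π` is the conjugate of `w`. -/
def Corresponds {n k : ℕ} (π : Equiv.Perm (Fin n)) (w : Fin n → Fin k) : Prop :=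
  ∀ j < n, row (marks π) n j = some (conj (ext w) j)

lemma cnt_some_eq {u : ℕ → Option ℕ} {v : ℕ → ℕ} {j : ℕ} (h : ∀ b < j, u b = some (v b)) (r : ℕ) :
    cnt u j (some r) = cnt v j r :=
  Finset.sum_congr rfl fun b hb => by rw [h b (Finset.mem_range.1 hb)]; simp

/-- Avoidance bounds the first row by `k`, so all column indices are below `k`; this is why the
conjugate word is the one over `k` letters. -/
lemma exists_corresponds_word {n k : ℕ} {π : Equiv.Perm (Fin n)} (hπ : Function.Involutive π)
    (hk : ¬ ContainsPattern π (increasingPattern k)) :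
    ∃ w ∈ Chamber.ballotWords k n, Corresponds π w := by
  have hX := isPartialInvolution_marks hπ
  rw [containsPattern_iff k hπ] at hk
  have hsome : ∀ j < n, ∃ r, row (marks π) n j = some r := by
    intro j hj
    rw [← Option.ne_none_iff_exists']
    intro h
    exact row_eq_none.1 h (π ⟨j, hj⟩) (π ⟨j, hj⟩).2 ((marks_iff π _ ⟨j, hj⟩).2 (hπ _))
  choose! v hv using hsome
  have hvb : NatBallotTo v n := by
    intro j hj r
    have := ballotTo_row hX n n j hj r
    rwa [cnt_some_eq fun b hb => hv b (by omega), cnt_some_eq fun b hb => hv b (by omega)] at this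
  have hlt : ∀ j < n, conj v j < k := by
    intro j hj
    have h1 : conj v j < cnt v (j + 1) (v j) := by
      rw [cnt_succ, if_pos rfl]; exact Nat.lt_succ_self _
    have h2 := hvb.antitone (show j + 1 ≤ n from hj) (Nat.zero_le (v j))
    have h3 := cnt_mono v (show j + 1 ≤ n from hj) 0
    rw [cnt_some_eq hv] at hk
    omega
  have hext : ∀ j < n, ext (fun j : Fin n => (⟨conj v j, hlt j j.2⟩ : Fin k)) j = conj v j := by
    intro j hj
    simp [ext, hj]
  refine ⟨fun j => ⟨conj v j, hlt j j.2⟩, ?_, ?_⟩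
  · simp only [Chamber.ballotWords, Finset.mem_filter, Finset.mem_univ, true_and, isBallot_iff]
    intro j hj r
    rw [cnt_congr fun b hb => hext b (by omega), cnt_congr fun b hb => hext b (by omega)]
    exact hvb.conj j hj r
  · intro j hj
    rw [hv j hj, conj_congr hext hj, conj_conj hvb hj]

lemma exists_corresponds_perm {n k : ℕ} {w : Fin n → Fin k} (hw : w ∈ Chamber.ballotWords k n) :
    ∃ π : Equiv.Perm (Fin n), Function.Involutive π ∧
      ¬ ContainsPattern π (increasingPattern k) ∧ Corresponds π w := by
  simp only [Chamber.ballotWords, Finset.mem_filter, Finset.mem_univ, true_and,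
    isBallot_iff] at hw
  have hsome : ∀ j, ∀ b < j, some (conj (ext w) b) = some (conj (ext w) b) := fun _ _ _ => rfl
  obtain ⟨X, hX, hr⟩ := exists_marks_of_ballotTo (w := fun j => some (conj (ext w) j)) (n := n)
    (fun j hj r => by
      rw [cnt_some_eq (hsome j), cnt_some_eq (hsome j)]
      exact hw.conj j hj r)
  -- No label of the last row is `none`, so every column contains a mark and the partial involution
  -- is total.
  have hex : ∀ i : Fin n, ∃ j : Fin n, X i j := by
    intro i
    have h1 : row X n i ≠ none := by rw [hr i i.2]; simp
    rw [Ne, row_eq_none] at h1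
    push Not at h1
    obtain ⟨a, ha, h⟩ := h1
    exact ⟨⟨a, ha⟩, hX.symm h⟩
  choose f hf using hex
  have hinv : Function.Involutive f := fun i => Fin.ext (hX.unique (hf (f i)) (hX.symm (hf i)))
  have hmarks : marks hinv.toPerm = X := by
    funext i j
    refine propext ⟨?_, fun h => ⟨hX.lt h, hX.unique (hf ⟨i, hX.lt h⟩) h⟩⟩
    rintro ⟨hi, rfl⟩
    exact hf ⟨i, hi⟩
  refine ⟨hinv.toPerm, hinv, ?_, fun j hj => by rw [hmarks, hr j hj]⟩
  -- Through conjugation, a first row longer than `k` would mean that the letter `k` occurs in `w`.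
  rw [containsPattern_iff k hinv, hmarks, cnt_some_eq hr, Nat.succ_le_iff,
    ← lt_cnt_iff_lt_cnt_conj hw le_rfl]
  intro h
  obtain ⟨b, hb, hb'⟩ := exists_of_cnt_pos h
  exact (ext_lt w hb).ne hb'

lemma Corresponds.perm_unique {n k : ℕ} {π π' : Equiv.Perm (Fin n)} {w : Fin n → Fin k}
    (hπ : Function.Involutive π) (hπ' : Function.Involutive π') (h : Corresponds π w)
    (h' : Corresponds π' w) : π = π' :=
  marks_injective (marks_eq_of_row_eq (isPartialInvolution_marks hπ)
    (isPartialInvolution_marks hπ') fun j hj => (h j hj).trans (h' j hj).symm)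

lemma Corresponds.word_unique {n k : ℕ} {π : Equiv.Perm (Fin n)} {w w' : Fin n → Fin k}
    (hw : w ∈ Chamber.ballotWords k n) (hw' : w' ∈ Chamber.ballotWords k n)
    (h : Corresponds π w) (h' : Corresponds π w') : w = w' := by
  simp only [Chamber.ballotWords, Finset.mem_filter, Finset.mem_univ, true_and,
    isBallot_iff] at hw hw'
  have hc : ∀ j < n, conj (ext w) j = conj (ext w') j := fun j hj =>
    Option.some_injective _ ((h j hj).symm.trans (h' j hj))
  funext j
  have := conj_congr hc j.2
  rw [conj_conj hw j.2, conj_conj hw' j.2, ext_val, ext_val] at this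
  exact Fin.ext this

lemma Corresponds.fp_eq {n k : ℕ} {π : Equiv.Perm (Fin n)} {w : Fin n → Fin k}
    (hπ : Function.Involutive π) (h : Corresponds π w) :
    fp π = (Chamber.oddCoords (Chamber.prefixCount w n)).card := by
  classical
  have h1 := sum_labelSign_row (isPartialInvolution_marks hπ) n
  rw [Finset.sum_congr rfl fun j hj => by rw [h j (Finset.mem_range.1 hj)]] at h1
  simp only [labelSign] at h1
  rw [← card_oddCoords w,
    ← Fin.sum_univ_eq_sum_range fun a => if marks π a a then (1 : ℤ) else 0] at h1
  have h2 : (fp π : ℤ) = ∑ a : Fin n, if marks π a a then (1 : ℤ) else 0 := by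
    rw [fp, Finset.card_filter]
    push_cast
    exact Finset.sum_congr rfl fun i _ => by simp only [marks_iff]
  exact_mod_cast h2.trans h1.symm

/-- Involutions without an increasing subsequence of length `k + 1` correspond to ballot words
over `k` letters, and fixed points correspond to letters of odd multiplicity. -/
theorem exists_equiv_ballotWords (k n : ℕ) :
    ∃ e : AvoidingInvolution n (increasingPattern k) ≃ Chamber.ballotWords k n,
      ∀ π, fp π.1 = (Chamber.oddCoords (Chamber.prefixCount (e π).1 n)).card := by
  choose f hf hf' using fun π : AvoidingInvolution n (increasingPattern k) =>
    exists_corresponds_word π.2.2 π.2.1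
  refine ⟨Equiv.ofBijective (fun π => ⟨f π, hf π⟩) ⟨fun π π' h => ?_, fun w => ?_⟩,
    fun π => (hf' π).fp_eq π.2.2⟩
  · have h' : f π = f π' := congrArg Subtype.val h
    exact Subtype.ext ((hf' π).perm_unique π.2.2 π'.2.2 (h' ▸ hf' π'))
  · obtain ⟨π, h1, h2, h3⟩ := exists_corresponds_perm w.2
    exact ⟨⟨π, h2, h1⟩, Subtype.ext ((hf' ⟨π, h2, h1⟩).word_unique (hf _) w.2 h3)⟩

end Growth

/-! ### The number of fixed points -/

instance (n : ℕ) {m : ℕ} (σ : Equiv.Perm (Fin m)) :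
    DiscreteMeasurableSpace (AvoidingInvolution n σ) := ⟨fun _ => trivial⟩

open Chamber

lemma sum_avoidingInvolution (k n : ℕ) (g : ℕ → ℝ) :
    ∑ π : AvoidingInvolution n (increasingPattern k), g (fp π.1) =
      ∑ i ∈ Finset.range (k + 1), g i * numBallotOdd k n i := by
  obtain ⟨e, he⟩ := Growth.exists_equiv_ballotWords k n
  have h1 : ∑ π : AvoidingInvolution n (increasingPattern k), g (fp π.1) =
      ballotSum (k := k) n fun c => g (oddCoords c).card := by
    rw [ballotSum, ← Finset.sum_coe_sort (ballotWords k n)]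
    exact (Finset.sum_congr rfl fun π _ => congrArg g (he π)).trans
      (e.sum_comp fun w => g (oddCoords (prefixCount w.1 n)).card)
  have h2 : ∀ c : Fin k → ℤ, g (oddCoords c).card =
      ∑ i ∈ Finset.range (k + 1), g i * if (oddCoords c).card = i then 1 else 0 := by
    intro c
    have : (oddCoords c).card < k + 1 :=
      Nat.lt_succ_of_le ((Finset.card_le_univ _).trans (by simp))
    simp [this]
  rw [h1]
  simp only [h2, ballotSum_finset_sum, ballotSum_const_mul]
  rfl

/-! ### The limiting mass functions -/

/-- The limiting mass functions for even (`s = 1`) and odd (`s = -1`) lengths. -/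
def parityMass (s : ℝ) (k : ℕ) (q : ℝ) (i : ℕ) : ℝ :=
  q ^ i * k.choose i * (1 + s * (-1) ^ i) / ((1 + q) ^ k + s * (1 - q) ^ k)

lemma evenMass_eq (k : ℕ) (q : ℝ) : evenMass k q = parityMass 1 k q := by
  funext i
  rcases Nat.even_or_odd i with h | h
  · simp only [evenMass, parityMass, h, if_true, h.neg_one_pow]; ring
  · simp [evenMass, parityMass, Nat.not_even_iff_odd.2 h, h.neg_one_pow]

lemma oddMass_eq (k : ℕ) (q : ℝ) : oddMass k q = parityMass (-1) k q := by
  funext i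
  rcases Nat.even_or_odd i with h | h
  · simp [oddMass, parityMass, Nat.not_odd_iff_even.2 h, h.neg_one_pow]
  · simp only [oddMass, parityMass, h, if_true, h.neg_one_pow]; ring

section

variable {k : ℕ} {q s : ℝ}

/-- Because `|1 - q| < 1 + q`. For `k = 0` and `s = -1` the denominator would vanish. -/
lemma parityMass_denom_pos (hk : 1 ≤ k) (hq : 0 < q) (hs : |s| = 1) :
    0 < (1 + q) ^ k + s * (1 - q) ^ k := by
  have h1 : |s * (1 - q) ^ k| < (1 + q) ^ k := by
    rw [abs_mul, hs, one_mul, abs_pow]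
    refine pow_lt_pow_left₀ ?_ (abs_nonneg _) (by omega)
    rw [abs_lt]; constructor <;> linarith
  have := neg_abs_le (s * (1 - q) ^ k)
  linarith

lemma parityMass_nonneg (hk : 1 ≤ k) (hq : 0 < q) (hs : |s| = 1) (i : ℕ) :
    0 ≤ parityMass s k q i := by
  have h1 : |s * (-1) ^ i| = 1 := by simp [abs_mul, hs]
  have h2 := neg_abs_le (s * (-1) ^ i)
  refine div_nonneg (mul_nonneg (by positivity) (by linarith)) (parityMass_denom_pos hk hq hs).le

lemma sum_pow_mul_choose_mul (k : ℕ) (q s : ℝ) :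
    ∑ i ∈ Finset.range (k + 1), q ^ i * k.choose i * (1 + s * (-1) ^ i) =
      (1 + q) ^ k + s * (1 - q) ^ k := by
  have h1 := add_pow q 1 k
  have h2 := add_pow (-q) 1 k
  simp only [one_pow, mul_one] at h1 h2
  rw [add_comm 1 q, h1, sub_eq_neg_add, h2, Finset.mul_sum, ← Finset.sum_add_distrib]
  refine Finset.sum_congr rfl fun i _ => ?_
  rw [neg_pow q]
  ring

lemma sum_parityMass (hk : 1 ≤ k) (hq : 0 < q) (hs : |s| = 1) :
    ∑ i ∈ Finset.range (k + 1), parityMass s k q i = 1 := by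
  simp only [parityMass, ← Finset.sum_div, sum_pow_mul_choose_mul]
  exact div_self (parityMass_denom_pos hk hq hs).ne'

lemma hasSum_parityMass (hk : 1 ≤ k) (hq : 0 < q) (hs : |s| = 1) :
    HasSum (parityMass s k q) 1 := by
  rw [← sum_parityMass hk hq hs]
  refine hasSum_sum_of_ne_finset_zero fun i hi => ?_
  rw [Finset.mem_range, not_lt] at hi
  simp [parityMass, Nat.choose_eq_zero_of_lt (show k < i by omega)]

/-! ### Averages under the biased measure -/

lemma totalWeight_pos (hk : 1 ≤ k) (hq : 0 < q) (n : ℕ) :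
    0 < totalWeight q (increasingPattern k) n := by
  have h1 := sum_avoidingInvolution k n fun _ => 1
  have h2 : ∑ i ∈ Finset.range (k + 1), 1 * numBallotOdd k n i = numBallot k n := by
    simp only [numBallot, numBallotOdd, one_mul, ← ballotSum_finset_sum]
    refine congrArg (ballotSum n) (funext fun c => ?_)
    have : (oddCoords c).card < k + 1 :=
      Nat.lt_succ_of_le ((Finset.card_le_univ _).trans (by simp))
    simp [this]
  have h3 := numBallot_pos hk n
  rw [← h2, ← h1] at h3
  have hne : (Finset.univ : Finset (AvoidingInvolution n (increasingPattern k))).Nonempty := by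
    by_contra h
    rw [Finset.not_nonempty_iff_eq_empty.1 h] at h3
    simp at h3
  exact Finset.sum_pos (fun π _ => pow_pos hq _) hne

lemma integral_biasedMeasure (hq : 0 < q) (hk : 1 ≤ k) (n : ℕ)
    (g : AvoidingInvolution n (increasingPattern k) → ℝ) :
    ∫ π, g π ∂biasedMeasure q (increasingPattern k) n =
      (∑ π, q ^ fp π.1 * g π) / totalWeight q (increasingPattern k) n := by
  rw [biasedMeasure, integral_finsetSum_measure, Finset.sum_div]
  · refine Finset.sum_congr rfl fun π _ => ?_
    rw [integral_smul_measure, integral_dirac, ENNReal.toReal_ofReal, smul_eq_mul]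
    · ring
    · have := totalWeight_pos hk hq n
      positivity
  · intro π _
    exact (integrable_dirac (by simp)).smul_measure ENNReal.ofReal_ne_top

lemma isProbabilityMeasure_biasedMeasure (hk : 1 ≤ k) (hq : 0 < q) (n : ℕ) :
    IsProbabilityMeasure (biasedMeasure q (increasingPattern k) n) := by
  have hW := totalWeight_pos hk hq n
  constructor
  simp only [biasedMeasure, Measure.coe_finsetSum, Finset.sum_apply, Measure.smul_apply,
    measure_univ, smul_eq_mul, mul_one]
  rw [← ENNReal.ofReal_sum_of_nonneg fun π _ => by positivity, ← Finset.sum_div]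
  change ENNReal.ofReal (totalWeight q (increasingPattern k) n / _) = 1
  rw [div_self hW.ne', ENNReal.ofReal_one]

lemma tendsto_numBallotOdd_comp (hk : 1 ≤ k) {u : ℕ → ℕ} (hu : Tendsto u atTop atTop)
    (hus : ∀ᶠ n in atTop, (-1 : ℝ) ^ u n = s) (i : ℕ) :
    Tendsto (fun n => numBallotOdd k (u n) i / numBallot k (u n)) atTop
      (nhds ((1 / 2) ^ k * k.choose i * (1 + s * (-1) ^ i))) := by
  have h := ((tendsto_numBallotOdd hk i).comp hu).add_const
    ((1 / 2 : ℝ) ^ k * k.choose i * (1 + s * (-1) ^ i))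
  rw [zero_add] at h
  refine h.congr' ?_
  filter_upwards [hus] with n hn
  simp only [Function.comp_apply]
  rw [pow_add, hn]
  ring

/-- Divide numerator and total weight by the number of ballot words: both converge, the common
factor `(1 / 2) ^ k` cancels, and the binomial theorem evaluates the denominator. -/
lemma tendsto_sum_div_totalWeight (hk : 1 ≤ k) (hq : 0 < q) (hs : |s| = 1) {u : ℕ → ℕ}
    (hu : Tendsto u atTop atTop) (hus : ∀ᶠ n in atTop, (-1 : ℝ) ^ u n = s) (g : ℕ → ℝ) :
    Tendsto (fun n => (∑ π : AvoidingInvolution (u n) (increasingPattern k),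
        q ^ fp π.1 * g (fp π.1)) / totalWeight q (increasingPattern k) (u n)) atTop
      (nhds (∑ i ∈ Finset.range (k + 1), parityMass s k q i * g i)) := by
  have hlim : ∀ g : ℕ → ℝ, Tendsto (fun n => (∑ π : AvoidingInvolution (u n) (increasingPattern k),
      q ^ fp π.1 * g (fp π.1)) / numBallot k (u n)) atTop
      (nhds (∑ i ∈ Finset.range (k + 1),
        q ^ i * g i * ((1 / 2) ^ k * k.choose i * (1 + s * (-1) ^ i)))) := by
    intro g
    have := tendsto_finsetSum (Finset.range (k + 1)) fun i _ =>
      (tendsto_numBallotOdd_comp hk hu hus i).const_mul (q ^ i * g i)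
    refine this.congr fun n => ?_
    rw [sum_avoidingInvolution k (u n) fun i => q ^ i * g i, Finset.sum_div]
    exact Finset.sum_congr rfl fun i _ => by rw [mul_div_assoc]
  have hD := parityMass_denom_pos hk hq hs
  have hone : ∑ i ∈ Finset.range (k + 1),
      q ^ i * 1 * ((1 / 2 : ℝ) ^ k * k.choose i * (1 + s * (-1) ^ i)) =
      (1 / 2) ^ k * ((1 + q) ^ k + s * (1 - q) ^ k) := by
    rw [← sum_pow_mul_choose_mul, Finset.mul_sum]
    exact Finset.sum_congr rfl fun i _ => by ring
  have h1 := hlim fun _ => 1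
  rw [hone] at h1
  have h2 := (hlim g).div h1 (by positivity)
  have hval : (∑ i ∈ Finset.range (k + 1),
        q ^ i * g i * ((1 / 2 : ℝ) ^ k * k.choose i * (1 + s * (-1) ^ i))) /
      ((1 / 2) ^ k * ((1 + q) ^ k + s * (1 - q) ^ k)) =
      ∑ i ∈ Finset.range (k + 1), parityMass s k q i * g i := by
    rw [Finset.sum_div]
    refine Finset.sum_congr rfl fun i _ => ?_
    rw [parityMass]
    field_simp
  rw [hval] at h2
  refine h2.congr fun n => ?_
  simp only [Pi.div_apply, mul_one]
  rw [div_div_div_cancel_right₀ (numBallot_pos hk (u n)).ne']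
  rfl

end

/-! ### Convergence in distribution -/

/-- The atoms at `0, …, N - 1` already exhaust the mass, so `ν` is carried by them. -/
lemma integral_eq_sum_of_measureReal_singleton {ν : Measure ℝ} [IsProbabilityMeasure ν]
    {m : ℕ → ℝ} {N : ℕ} (hm : ∀ i < N, ν.real {(i : ℝ)} = m i)
    (hsum : ∑ i ∈ Finset.range N, m i = 1) (f : BoundedContinuousFunction ℝ ℝ) :
    ∫ x, f x ∂ν = ∑ i ∈ Finset.range N, m i * f i := by
  set S : Finset ℝ := (Finset.range N).map Nat.castEmbedding with hS
  have hS1 : ν.real S = 1 := by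
    rw [← sum_measureReal_singleton, hS, Finset.sum_map, ← hsum]
    exact Finset.sum_congr rfl fun i hi => hm i (Finset.mem_range.1 hi)
  have hae : ∀ᵐ x ∂ν, x ∈ (S : Set ℝ) := by
    refine (mem_ae_iff_prob_eq_one S.measurableSet).2 ?_
    rwa [measureReal_def, ENNReal.toReal_eq_one_iff] at hS1
  rw [← setIntegral_eq_integral_of_ae_compl_eq_zero (s := (S : Set ℝ))
    (hae.mono fun x hx h => absurd hx h), setIntegral_finset _ (f.integrable ν).integrableOn, hS,
    Finset.sum_map]
  refine Finset.sum_congr rfl fun i hi => ?_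
  rw [← hm i (Finset.mem_range.1 hi)]
  rfl

lemma tendstoInDistribution_fp {k : ℕ} {q s : ℝ} (hk : 1 ≤ k) (hq : 0 < q) (hs : |s| = 1)
    {u : ℕ → ℕ} (hu : Tendsto u atTop atTop) (hus : ∀ᶠ n in atTop, (-1 : ℝ) ^ u n = s)
    {Ω : ℕ → Type*} [∀ n, MeasurableSpace (Ω n)]
    (P : ∀ n, Measure (Ω n)) [∀ n, IsProbabilityMeasure (P n)]
    (Pi : ∀ n, Ω n → AvoidingInvolution n (increasingPattern k))
    (hlaw : ∀ n, HasLaw (Pi n) (biasedMeasure q (increasingPattern k) n) (P n))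
    {Ω' : Type*} [MeasurableSpace Ω'] (P' : Measure Ω') [IsProbabilityMeasure P']
    (X : Ω' → ℝ) (hX : AEMeasurable X P')
    (hmass : ∀ i : ℕ, P'.real {ω | X ω = (i : ℝ)} = parityMass s k q i) :
    TendstoInDistribution (fun n ω => (fp (Pi (u n) ω).1 : ℝ)) atTop X (fun n => P (u n)) P' := by
  have hmeas : ∀ n, AEMeasurable (fun ω => (fp (Pi n ω).1 : ℝ)) (P n) := fun n =>
    (Measurable.of_discrete (f := fun π : AvoidingInvolution n (increasingPattern k) =>
      (fp π.1 : ℝ))).comp_aemeasurable (hlaw n).aemeasurable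
  refine ⟨fun n => hmeas (u n), hX, ?_⟩
  refine ProbabilityMeasure.tendsto_iff_forall_integral_tendsto.2 fun f => ?_
  have : IsProbabilityMeasure (P'.map X) := Measure.isProbabilityMeasure_map hX
  have hlim : ∫ x, f x ∂(P'.map X) = ∑ i ∈ Finset.range (k + 1), parityMass s k q i * f i := by
    refine integral_eq_sum_of_measureReal_singleton (fun i _ => ?_) (sum_parityMass hk hq hs) f
    rw [map_measureReal_apply_of_aemeasurable hX (measurableSet_singleton _), ← hmass i]
    rfl
  have hn : ∀ n, ∫ x, f x ∂((P n).map fun ω => (fp (Pi n ω).1 : ℝ)) =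
      (∑ π : AvoidingInvolution n (increasingPattern k),
        q ^ fp π.1 * f (fp π.1)) / totalWeight q (increasingPattern k) n := by
    intro n
    rw [integral_map (hmeas n) f.continuous.aestronglyMeasurable,
      ← integral_biasedMeasure hq hk n fun π => f (fp π.1), ← (hlaw n).map_eq,
      integral_map (hlaw n).aemeasurable (Measurable.of_discrete).aestronglyMeasurable]
  have h := tendsto_sum_div_totalWeight hk hq hs hu hus fun i => f i
  rw [← hlim] at h
  exact h.congr fun n => (hn (u n)).symm

end

theorem theorem1 (k : ℕ) (hk : 1 ≤ k) (q : ℝ) (hq : 0 < q) :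
    -- the fixed point biased measures are probability measures
    (∀ n : ℕ, IsProbabilityMeasure (biasedMeasure q (increasingPattern k) n)) ∧
    -- the two limiting mass functions are probability mass functions
    ((∀ i, 0 ≤ evenMass k q i) ∧ HasSum (evenMass k q) 1) ∧
    ((∀ i, 0 ≤ oddMass k q i) ∧ HasSum (oddMass k q) 1) ∧
    -- convergence in distribution of the number of fixed points along even and odd lengths
    ∀ (Ω : ℕ → Type*) [∀ n, MeasurableSpace (Ω n)]
      (P : ∀ n, Measure (Ω n)) [∀ n, IsProbabilityMeasure (P n)]
      (Pi : ∀ n, Ω n → AvoidingInvolution n (increasingPattern k)),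
      (∀ n, HasLaw (Pi n) (biasedMeasure q (increasingPattern k) n) (P n)) →
      (∀ (Ω' : Type*) [MeasurableSpace Ω'] (P' : Measure Ω') [IsProbabilityMeasure P']
        (X : Ω' → ℝ), AEMeasurable X P' →
        (∀ i : ℕ, P'.real {ω | X ω = (i : ℝ)} = evenMass k q i) →
        TendstoInDistribution (fun n ω => (fp (Pi (2 * n) ω).1 : ℝ)) atTop X
          (fun n => P (2 * n)) P') ∧
      (∀ (Ω' : Type*) [MeasurableSpace Ω'] (P' : Measure Ω') [IsProbabilityMeasure P']
        (X : Ω' → ℝ), AEMeasurable X P' →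
        (∀ i : ℕ, P'.real {ω | X ω = (i : ℝ)} = oddMass k q i) →
        TendstoInDistribution (fun n ω => (fp (Pi (2 * n - 1) ω).1 : ℝ)) atTop X
          (fun n => P (2 * n - 1)) P') := by
  have h1 : |(1 : ℝ)| = 1 := abs_one
  have h2 : |(-1 : ℝ)| = 1 := by simp
  simp only [evenMass_eq, oddMass_eq]
  refine ⟨isProbabilityMeasure_biasedMeasure hk hq,
    ⟨parityMass_nonneg hk hq h1, hasSum_parityMass hk hq h1⟩,
    ⟨parityMass_nonneg hk hq h2, hasSum_parityMass hk hq h2⟩, ?_⟩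
  intro Ω _ P _ Pi hlaw
  refine ⟨fun Ω' _ P' _ X hX hm => ?_, fun Ω' _ P' _ X hX hm => ?_⟩
  · refine tendstoInDistribution_fp hk hq h1
      (tendsto_atTop_mono (fun n => by rw [id]; omega) tendsto_id)
      (Eventually.of_forall fun n => ?_) P Pi hlaw P' X hX hm
    simp [pow_mul]
  -- At `n = 0` truncated subtraction makes the length `2 * n - 1` equal to 0, which is even, so
  -- parity and growth are only claimed for `n ≥ 1`.
  · refine tendstoInDistribution_fp hk hq h2
      (tendsto_atTop_mono' _ ?_ tendsto_id) ?_ P Pi hlaw P' X hX hm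
    · filter_upwards [eventually_ge_atTop 1] with n hn
      simp only [id]; omega
    · filter_upwards [eventually_ge_atTop 1] with n hn
      exact Odd.neg_one_pow ⟨n - 1, by omega⟩
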